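/- Let $X$ be a Dedekind complete Riesz space with a weak order unit $e$, and let $T$ be a conditional expectation operator on $X$ with $Te=e$, that is, $T:X\to X$ is an order continuous, strictly positive linear projection whose range is a Dedekind complete Riesz subspace of $X$. Let $X^u$ be the universal completion of $X$. Let $X^s$ be the sup-completion of $X$, that is, the set of nonempty upward directed subsets of $X$ modulo the relation $A\sim B\iff \sup_{a\in A}(x\wedge a)=\sup_{b\in B}(x\wedge b)$ for all $x\in X$, with the induced order and addition; $X$ is identified with the classes of singletons, $\infty$ is the greatest element of $X^s$, each $0\le u\in X^u$ is identified with $\sup\{x\in X: x\le u\}\in X^s$, and $\infty_B=\sup (B\cap X)\in X^s$ for a band $B$ of $X^u$. A sum $\sum_n x_n$ with $0\le x_n\in X$ means the supremum in $X^s$ of the partial sums. Let $(P_n)_{n\ge 1}$ be a sequence of $T$-independent band projections on $X$, that is, $$T P_{k_1}P_{k_2}\cdots P_{k_m}e=(TP_{k_1})(TP_{k_2})\cdots (TP_{k_m})e$$ for all distinct indices $k_1,\dots,k_m$ (products are compositions). If $B$ is a band of $X^u$ and $0\le u\in X^u$ with $u\in B^d$ are such that $$\sum_{n\ge1}TP_ne=\infty_B+u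 \quad\text{in } X^s,$$ then the band projection $P_B$ (acting on $X$, i.e. the band projection of $X$ onto $B\cap X$) commutes with $T$, and $$P_B=\limsup_{n\to\infty}P_n:=\inf_{n}\,\sup_{k\ge n}P_k,$$ where the infimum and suprema are taken in the ordered set of band projections of $X$. In particular, if $\sum_{n\ge1}TP_ne=\infty$, then $\limsup_{n\to\infty}P_n=I$. -/

import Mathlib

/-!
Throughout, a Riesz space is a real vector space with a lattice order compatible with the vector
space operations: `[AddCommGroup X] [Module ℝ X] [Lattice X] [IsOrderedAddMonoid X]
[IsOrderedModule ℝ X]`; it is Dedekind complete when the lattice is a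
`ConditionallyCompleteLattice`.
-/

namespace Riesz

section Bands

variable {X : Type*} [AddCommGroup X] [Module ℝ X] [Lattice X]

/-- A band: a solid linear subspace that contains the suprema (existing in `X`) of its subsets. -/
structure Band (X : Type*) [AddCommGroup X] [Module ℝ X] [Lattice X]
    extends Submodule ℝ X where
  solid : ∀ x y : X, x ∈ carrier → |y| ≤ |x| → y ∈ carrier
  sup_mem : ∀ (S : Set X) (m : X), S ⊆ carrier → IsLUB S m → m ∈ carrier

/-- The disjoint complement `Bᵈ` of a band, as a set. -/
def Band.compl (B : Band X) : Set X := {x | ∀ b ∈ B.toSubmodule, |x| ⊓ |b| = 0}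

/-- `P` is a band projection: for some band `B`, every `P x` is the component of `x` in `B` for
the decomposition `X = B ⊕ Bᵈ`. -/
def IsBandProjection (P : X →ₗ[ℝ] X) : Prop :=
  ∃ B : Band X, ∀ x, P x ∈ B.toSubmodule ∧ x - P x ∈ B.compl

/-- The band projections of `X`. -/
structure BandProj (X : Type*) [AddCommGroup X] [Module ℝ X] [Lattice X] where
  toMap : X →ₗ[ℝ] X
  isBandProjection : IsBandProjection toMap

/-- `P ≤ Q` means `P x ≤ Q x` for all `x ≥ 0`. -/
instance [IsOrderedAddMonoid X] : PartialOrder (BandProj X) where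
  le P Q := ∀ x, 0 ≤ x → P.toMap x ≤ Q.toMap x
  le_refl _ _ _ := le_rfl
  le_trans _ _ _ h₁ h₂ x hx := (h₁ x hx).trans (h₂ x hx)
  le_antisymm P Q h₁ h₂ := by
    have h : P.toMap = Q.toMap := by
      ext x
      have hp : ∀ y, 0 ≤ y → P.toMap y = Q.toMap y := fun y hy => le_antisymm (h₁ y hy) (h₂ y hy)
      rw [← posPart_sub_negPart x, map_sub, map_sub, hp _ (posPart_nonneg x),
        hp _ (negPart_nonneg x)]
    cases P; cases Q; simp_all

/-- The identity, which is the band projection onto `X`. -/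
instance [IsOrderedAddMonoid X] : One (BandProj X) where
  one := ⟨LinearMap.id, ⟨⊤, fun _ _ _ _ => trivial, fun _ _ _ _ => trivial⟩, fun x => by
    refine ⟨trivial, fun b _ => ?_⟩
    simp⟩

/-- `Q = limsup Pₙ = infₙ sup_{k ≥ n} Pₖ` in the ordered set of band projections. -/
def IsLimsup [IsOrderedAddMonoid X] (P : ℕ → BandProj X) (Q : BandProj X) : Prop :=
  ∃ R : ℕ → BandProj X, (∀ n, IsLUB (P '' Set.Ici n) (R n)) ∧ IsGLB (Set.range R) Q

/-- A weak order unit: a positive element disjoint from no nonzero positive element. -/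
def IsWeakOrderUnit (e : X) : Prop :=
  0 ≤ e ∧ ∀ x : X, 0 ≤ x → x ⊓ e = 0 → x = 0

/-- A conditional expectation operator: an order continuous strictly positive linear projection
whose range is a Dedekind complete Riesz subspace. (For a positive linear map, order continuity
is preservation of downward directed infima equal to `0`.) -/
structure IsConditionalExpectation (T : X →ₗ[ℝ] X) : Prop where
  idem : ∀ x, T (T x) = T x
  strictlyPositive : ∀ x, 0 < x → 0 < T x
  orderContinuous : ∀ S : Set X, S.Nonempty → DirectedOn (· ≥ ·) S → IsGLB S 0 → IsGLB (T '' S) 0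
  range_sup : ∀ x y, T x ⊔ T y ∈ LinearMap.range T
  range_dedekindComplete : ∀ S : Set (LinearMap.range T), S.Nonempty → BddAbove S →
    ∃ m, IsLUB S m

/-- `T`-independence of a sequence of band projections: for any distinct indices `k₁, …, kₘ`,
`T P_{k₁} ⋯ P_{kₘ} e = (T P_{k₁}) ⋯ (T P_{kₘ}) e`, the products being compositions. -/
def TIndependent (T : X →ₗ[ℝ] X) (e : X) (P : ℕ → BandProj X) : Prop :=
  ∀ l : List ℕ, l.Nodup →
    T ((l.map fun k => ((P k).toMap : Module.End ℝ X)).prod e) =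
      (l.map fun k => (T * (P k).toMap : Module.End ℝ X)).prod e

end Bands

section SupCompletion

variable {X : Type*} [AddCommGroup X] [ConditionallyCompleteLattice X]

/-- The nonempty upward directed subsets of `X`. -/
structure DirSet (X : Type*) [LE X] where
  carrier : Set X
  nonempty : carrier.Nonempty
  directed : DirectedOn (· ≤ ·) carrier

/-- `sup_{a ∈ A} (x ∧ a)`. -/
noncomputable def DirSet.cut (A : DirSet X) (x : X) : X := sSup ((fun a => x ⊓ a) '' A.carrier)

/-- `A ∼ B` when `sup_{a ∈ A} (x ∧ a) = sup_{b ∈ B} (x ∧ b)` for all `x ∈ X`. -/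
instance DirSet.setoid (X : Type*) [ConditionallyCompleteLattice X] : Setoid (DirSet X) where
  r A B := ∀ x, sSup ((fun a => x ⊓ a) '' A.carrier) = sSup ((fun b => x ⊓ b) '' B.carrier)
  iseqv := ⟨fun _ _ => rfl, fun h x => (h x).symm, fun h k x => (h x).trans (k x)⟩

/-- The sup-completion `Xˢ` of a Dedekind complete Riesz space. -/
def SupCompletion (X : Type*) [ConditionallyCompleteLattice X] : Type _ :=
  Quotient (DirSet.setoid X)

theorem DirSet.cut_isLUB {X : Type*} [ConditionallyCompleteLattice X] (A : DirSet X) (x : X) :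
    IsLUB ((fun a => x ⊓ a) '' A.carrier) (A.cut x) :=
  isLUB_csSup (A.nonempty.image _) ⟨x, by rintro _ ⟨a, _, rfl⟩; exact inf_le_left⟩

/-- The class in `Xˢ` of a nonempty upward directed set; it is the supremum of that set in `Xˢ`. -/
def SupCompletion.mk (A : DirSet X) : SupCompletion X := Quotient.mk _ A

/-- `X` as a subset of `Xˢ`: the class of `{x}`. -/
def SupCompletion.of (x : X) : SupCompletion X :=
  SupCompletion.mk ⟨{x}, Set.singleton_nonempty x, directedOn_singleton x⟩

/-- The order of `Xˢ`: `[A] ≤ [B]` when `sup_{a ∈ A} (x ∧ a) ≤ sup_{b ∈ B} (x ∧ b)` for all `x`. -/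
instance : PartialOrder (SupCompletion X) where
  le := Quotient.lift₂ (fun A B => ∀ x, A.cut x ≤ B.cut x) (by
    intro A B A' B' hA hB
    refine propext (forall_congr' fun x => ?_)
    rw [show A.cut x = A'.cut x from hA x, show B.cut x = B'.cut x from hB x])
  le_refl a := Quotient.inductionOn a fun _ _ => le_rfl
  le_trans a b c := Quotient.inductionOn₃ a b c fun _ _ _ h k x => (h x).trans (k x)
  le_antisymm a b := Quotient.inductionOn₂ a b fun _ _ h k =>
    Quotient.sound fun x => le_antisymm (h x) (k x)

/-- The greatest element `∞` of `Xˢ`: the class of `X` itself. -/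
instance : OrderTop (SupCompletion X) where
  top := SupCompletion.mk ⟨Set.univ, ⟨0, trivial⟩, fun x _ y _ =>
    ⟨x ⊔ y, trivial, le_sup_left, le_sup_right⟩⟩
  le_top a := Quotient.inductionOn a fun A x => (isLUB_le_iff (A.cut_isLUB x)).2 (by
    rintro _ ⟨a, _, rfl⟩
    exact (DirSet.cut_isLUB _ x).1 ⟨a, trivial, rfl⟩)

variable [IsOrderedAddMonoid X]

/-- Addition of directed sets: `A + B = {a + b | a ∈ A, b ∈ B}`. -/
def DirSet.add (A B : DirSet X) : DirSet X where
  carrier := {z | ∃ a ∈ A.carrier, ∃ b ∈ B.carrier, z = a + b}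
  nonempty := by
    obtain ⟨a, ha⟩ := A.nonempty
    obtain ⟨b, hb⟩ := B.nonempty
    exact ⟨a + b, a, ha, b, hb, rfl⟩
  directed := by
    rintro _ ⟨a, ha, b, hb, rfl⟩ _ ⟨a', ha', b', hb', rfl⟩
    obtain ⟨c, hc, h₁, h₂⟩ := A.directed a ha a' ha'
    obtain ⟨d, hd, h₃, h₄⟩ := B.directed b hb b' hb'
    exact ⟨c + d, ⟨c, hc, d, hd, rfl⟩, add_le_add h₁ h₃, add_le_add h₂ h₄⟩

theorem inf_le_of_isLUB {S : Set X} {m x c : X} (hm : IsLUB S m) (h : ∀ s ∈ S, x ⊓ s ≤ c) :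
    x ⊓ m ≤ c := by
  have h₁ : m ≤ c + x ⊔ m - x := hm.2 fun s hs => by
    have h₂ : x ⊓ s + x ⊔ s = x + s := inf_add_sup x s
    have h₃ : x ⊔ s ≤ x ⊔ m := sup_le_sup_left (hm.1 hs) x
    have h₄ := add_le_add (h s hs) h₃
    rw [h₂] at h₄
    exact le_sub_iff_add_le'.2 h₄
  have h₂ : x ⊓ m + x ⊔ m = x + m := inf_add_sup x m
  have h₃ := le_sub_iff_add_le'.1 h₁
  rw [← h₂] at h₃
  exact le_of_add_le_add_right h₃

theorem DirSet.add_mono {A A' B B' : DirSet X} (hA : ∀ x, A.cut x ≤ A'.cut x)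
    (hB : ∀ x, B.cut x ≤ B'.cut x) (x : X) : (A.add B).cut x ≤ (A'.add B').cut x := by
  have key : ∀ {C C' : DirSet X}, (∀ x, C.cut x ≤ C'.cut x) → ∀ c ∈ C.carrier,
      IsLUB ((fun d => c ⊓ d) '' C'.carrier) c := by
    intro C C' h c hc
    have h₁ : c ≤ C.cut c := (C.cut_isLUB c).1 ⟨c, hc, inf_idem c⟩
    refine ⟨by rintro _ ⟨d, _, rfl⟩; exact inf_le_left, fun w hw => ?_⟩
    exact (h₁.trans (h c)).trans ((C'.cut_isLUB c).2 hw)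
  refine ((A.add B).cut_isLUB x).2 ?_
  rintro _ ⟨_, ⟨a, ha, b, hb, rfl⟩, rfl⟩
  refine inf_le_of_isLUB ((key hA a ha).add (key hB b hb)) ?_
  rintro _ ⟨_, ⟨a', ha', rfl⟩, _, ⟨b', hb', rfl⟩, rfl⟩
  exact (inf_le_inf_left x (add_le_add inf_le_right inf_le_right)).trans
    (((A'.add B').cut_isLUB x).1 ⟨a' + b', ⟨a', ha', b', hb', rfl⟩, rfl⟩)

/-- The addition of `Xˢ`. -/
instance : Add (SupCompletion X) where
  add := Quotient.map₂ DirSet.add fun _ _ hA _ _ hB x => le_antisymm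
    (DirSet.add_mono (fun y => (hA y).le) (fun y => (hB y).le) x)
    (DirSet.add_mono (fun y => (hA y).ge) (fun y => (hB y).ge) x)

/-- `∑ₙ xₙ = s` in `Xˢ`, for a sequence of positive elements `xₙ` of `X`: `s` is the supremum of
the partial sums. -/
def HasSupSum (x : ℕ → X) (s : SupCompletion X) : Prop :=
  IsLUB (Set.range fun n => SupCompletion.of (∑ k ∈ Finset.range n, x k)) s

end SupCompletion

section UniversalCompletion

variable {X Y : Type*}
  [AddCommGroup X] [Module ℝ X] [ConditionallyCompleteLattice X] [IsOrderedAddMonoid X]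
  [AddCommGroup Y] [Module ℝ Y] [ConditionallyCompleteLattice Y] [IsOrderedAddMonoid Y]

/-- `Y`, which is Dedekind complete, is the universal completion `Xᵘ` of `X` through `ι`: it is
laterally complete (hence universally complete), and `ι` is an isomorphism of Riesz spaces from
`X` onto an order dense Riesz subspace of `Y`. -/
structure IsUniversalCompletion (ι : X →ₗ[ℝ] Y) : Prop where
  injective : Function.Injective ι
  map_sup : ∀ x y, ι (x ⊔ y) = ι x ⊔ ι y
  orderDense : ∀ y : Y, 0 < y → ∃ x : X, 0 < ι x ∧ ι x ≤ y
  laterallyComplete : ∀ S : Set Y, S.Nonempty → (∀ y ∈ S, 0 ≤ y) →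
    S.Pairwise (fun y z => y ⊓ z = 0) → ∃ m, IsLUB S m

/-- The element of `Xˢ` given by `u ∈ Xᵘ`, `u ≥ 0`: the supremum in `Xˢ` of the `x ∈ X` below
`u`. -/
def IsUniversalCompletion.toSup {ι : X →ₗ[ℝ] Y} (h : IsUniversalCompletion ι) (u : Y)
    (hu : 0 ≤ u) : SupCompletion X :=
  SupCompletion.mk ⟨{x | ι x ≤ u}, ⟨0, by simpa using hu⟩, fun x hx y hy =>
    ⟨x ⊔ y, by
      change ι (x ⊔ y) ≤ u
      rw [h.map_sup]
      exact sup_le hx hy, le_sup_left, le_sup_right⟩⟩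

/-- The element `∞_B` of `Xˢ` for a band `B` of `Xᵘ`: the supremum in `Xˢ` of `B ∩ X`. -/
def IsUniversalCompletion.infty {ι : X →ₗ[ℝ] Y} (h : IsUniversalCompletion ι) (B : Band Y) :
    SupCompletion X :=
  SupCompletion.mk ⟨{x | ι x ∈ B.toSubmodule}, ⟨0, by simp⟩, fun x hx y hy =>
    ⟨x ⊔ y, by
      change ι (x ⊔ y) ∈ B.toSubmodule
      rw [h.map_sup]
      refine B.sup_mem {ι x, ι y} _ ?_ isLUB_pair
      rintro z (rfl | rfl)
      exacts [hx, hy], le_sup_left, le_sup_right⟩⟩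

/-- `Q` is the band projection `P_B` of a band `B` of `Xᵘ`, acting on `X`: each `Q x` is the
component of `x` in `B` for the decomposition `Xᵘ = B ⊕ Bᵈ`. -/
def BandProj.IsOnto (Q : BandProj X) (ι : X →ₗ[ℝ] Y) (B : Band Y) : Prop :=
  ∀ x, ι (Q.toMap x) ∈ B.toSubmodule ∧ ι (x - Q.toMap x) ∈ B.compl

end UniversalCompletion

end Riesz

open Riesz

/-!
The proof combines the two Borel–Cantelli lemmas. Let `sₙ = ∑_{k < n} T P_k e`, an increasing
sequence of elements fixed by `T`. The data `∞_B + u` enter only through the *divergence part* of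
`s` (`IsDivergenceProj`): the band whose complement is the supremum, over `m`, of the bands `D_m` on
which `s` is bounded by `m e`, namely the disjoint complements of `{(sₙ - m e)⁺}`. Since truncation
in `X` computes suprema in the sup-completion and `X` is order dense in its universal completion,
`P_B` is the projection onto this divergence part (`IsUniversalCompletion.isDivergenceProj`), and so
is `I` when the sum is `∞`.

*Commutation with `T`.* A band projection commutes with `T` as soon as `T` fixes its value at `e`
(`IsConditionalExpectation.commute_of_map_unit`). The fixed points of `T` are closed under the
lattice operations and under monotone limits, and the values at `e` of the projections onto `D_m`
and onto the divergence part are obtained from `sₙ` and `e` by such operations.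

*Convergence part* (`map_level_eq_zero_of_le_tail`). On `D_m` the sum `σ = ∑ T P_k e` is bounded, so
`T` of the tail supremum `sup_{k ≥ n} P_k` is at most `σ - sₙ`, which decreases to `0`; by strict
positivity of `T` the limit superior vanishes on `D_m`.

*Divergence part* (`IsDivergenceProj.map_common_kernel_eq_zero`). Put
`y_i = T (1 - P_{n+i-1}) ⋯ (1 - P_n) e`. Independence gives `y_{i+1} = y_i - T P_{n+i} y_i`, and this
telescopes to `∑ T P_{n+i} y_i ≤ e`. With `y = inf y_i` also `∑ T P_{n+i} y ≤ e`. On the band where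
`j y ≥ e` the sum `s` would then be bounded by a multiple of `e`, so within the divergence part `y`
is at most `e / j` for every `j`, hence zero there
(`IsDivergenceProj.map_eq_zero_of_sum_le`). Consequently the common kernel of
`P_n, P_{n+1}, …` does not meet the divergence part.
-/


/-! ### Lattice ordered groups -/

section LatticeGroup

variable {X : Type*} [AddCommGroup X] [Lattice X] [IsOrderedAddMonoid X]

theorem add_inf_le_inf_add_inf {a b c : X} (ha : 0 ≤ a) (hb : 0 ≤ b) (hc : 0 ≤ c) :
    (a + b) ⊓ c ≤ a ⊓ c + b ⊓ c := by
  rw [add_inf, inf_add, inf_add]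
  refine le_inf (le_inf inf_le_left ?_) (le_inf ?_ ?_)
  · exact inf_le_right.trans (le_add_of_nonneg_right hb)
  · exact inf_le_right.trans (le_add_of_nonneg_left ha)
  · exact inf_le_right.trans (le_add_of_nonneg_left hc)

theorem add_inf_eq_zero {a b c : X} (ha : 0 ≤ a) (hb : 0 ≤ b) (hc : 0 ≤ c) (hac : a ⊓ c = 0)
    (hbc : b ⊓ c = 0) : (a + b) ⊓ c = 0 :=
  le_antisymm ((add_inf_le_inf_add_inf ha hb hc).trans (by rw [hac, hbc, add_zero]))
    (le_inf (add_nonneg ha hb) hc)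

theorem nsmul_inf_eq_zero {a c : X} (ha : 0 ≤ a) (hc : 0 ≤ c) (hac : a ⊓ c = 0) (n : ℕ) :
    (n • a) ⊓ c = 0 := by
  induction n with
  | zero => simpa using hc
  | succ n ih => rw [succ_nsmul]; exact add_inf_eq_zero (nsmul_nonneg ha n) ha hc ih hac

theorem inf_eq_zero_of_le {X : Type*} [AddCommGroup X] [Lattice X] {a b c : X} (ha : 0 ≤ a)
    (hab : a ≤ b) (hc : 0 ≤ c) (h : b ⊓ c = 0) :
    a ⊓ c = 0 :=
  le_antisymm ((inf_le_inf_right c hab).trans h.le) (le_inf ha hc)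

theorem negPart_le_abs_self (a : X) : a⁻ ≤ |a| := sup_le (neg_le_abs a) (abs_nonneg a)

theorem nonneg_of_add_nonneg_of_abs_inf_abs_eq_zero {a b : X} (h : 0 ≤ a + b)
    (hab : |a| ⊓ |b| = 0) : 0 ≤ a := by
  have h₁ : a⁻ ≤ |b| := sup_le ((neg_le_iff_add_nonneg'.2 h).trans (le_abs_self b)) (abs_nonneg b)
  exact negPart_eq_zero.1 (le_antisymm ((le_inf (negPart_le_abs_self a) h₁).trans hab.le)
    (negPart_nonneg a))

end LatticeGroup

section DedekindComplete

variable {X : Type*} [AddCommGroup X] [ConditionallyCompleteLattice X] [IsOrderedAddMonoid X]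

/-- A Dedekind complete Riesz space is Archimedean. -/
theorem nonpos_of_forall_nsmul_le {a b : X} (h : ∀ n : ℕ, n • a ≤ b) : a ≤ 0 := by
  have hS : IsLUB (Set.range fun n : ℕ => n • a) (sSup (Set.range fun n : ℕ => n • a)) :=
    isLUB_csSup (Set.range_nonempty _) ⟨b, by rintro _ ⟨n, rfl⟩; exact h n⟩
  have h₁ : sSup (Set.range fun n : ℕ => n • a) ≤ sSup (Set.range fun n : ℕ => n • a) - a := by
    refine hS.2 ?_
    rintro _ ⟨n, rfl⟩
    rw [le_sub_iff_add_le, ← succ_nsmul]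
    exact hS.1 ⟨n + 1, rfl⟩
  simpa using h₁

/-- The part of `x` outside the supremum of the truncations `x ∧ n fₙ` is disjoint from every
`fₙ`. -/
theorem sub_inf_eq_zero_of_isLUB {x a : X} {f : ℕ → X} (hf : Monotone f) (hf₀ : ∀ n, 0 ≤ f n)
    (ha : IsLUB (Set.range fun n : ℕ => x ⊓ n • f n) a) (n : ℕ) :
    (x - a) ⊓ f n = 0 := by
  have hx : a ≤ x := ha.2 (by rintro _ ⟨n, rfl⟩; exact inf_le_left)
  have hmono : Monotone fun n : ℕ => x ⊓ n • f n := fun i j hij => inf_le_inf_left x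
    ((nsmul_le_nsmul_right (hf hij) i).trans (nsmul_le_nsmul_left (hf₀ j) hij))
  refine le_antisymm ?_ (le_inf (sub_nonneg.2 hx) (hf₀ n))
  have h : a ≤ a - (x - a) ⊓ f n := by
    refine ha.2 ?_
    rintro _ ⟨k, rfl⟩
    rw [le_sub_iff_add_le]
    refine (add_le_add_left (hmono (le_max_left k n)) _).trans ?_
    refine le_trans ?_ (ha.1 ⟨max k n + 1, rfl⟩)
    refine le_inf ?_ ?_
    · calc _ ≤ a + (x - a) := add_le_add (ha.1 ⟨_, rfl⟩) inf_le_left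
        _ = x := by abel
    · rw [succ_nsmul]
      refine add_le_add (inf_le_right.trans (nsmul_le_nsmul_right (hf (Nat.le_succ _)) _))
        (inf_le_right.trans (hf ((le_max_right k n).trans (Nat.le_succ _))))
  simpa using h

/-- A positive element is the supremum of its truncations at the multiples of a weak order unit. -/
theorem isLUB_inf_nsmul {e : X} (he : IsWeakOrderUnit e) (x : X) :
    IsLUB (Set.range fun n : ℕ => x ⊓ n • e) x := by
  have ha : IsLUB (Set.range fun n : ℕ => x ⊓ n • e) (sSup (Set.range fun n : ℕ => x ⊓ n • e)) :=
    isLUB_csSup (Set.range_nonempty _) ⟨x, by rintro _ ⟨n, rfl⟩; exact inf_le_left⟩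
  have hle : sSup (Set.range fun n : ℕ => x ⊓ n • e) ≤ x :=
    ha.2 (by rintro _ ⟨n, rfl⟩; exact inf_le_left)
  have h := he.2 _ (sub_nonneg.2 hle)
    (sub_inf_eq_zero_of_isLUB (f := fun _ => e) monotone_const (fun _ => he.1) ha 0)
  rwa [← sub_eq_zero.1 h] at ha

end DedekindComplete

/-! ### Band projections -/

section OrderProjection

variable {X : Type*} [AddCommGroup X] [Module ℝ X] [Lattice X]

/-- A linear map `P` with `P² = P` and `0 ≤ P ≤ 1`. These are exactly the band projections; in this
form they are closed under composition and complements. -/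
structure IsOrderProj (P : X →ₗ[ℝ] X) : Prop where
  idem : ∀ x, P (P x) = P x
  nonneg : ∀ x, 0 ≤ x → 0 ≤ P x
  le_self : ∀ x, 0 ≤ x → P x ≤ x

variable [IsOrderedAddMonoid X]

theorem LinearMap.eq_of_forall_nonneg {P Q : X →ₗ[ℝ] X} (h : ∀ x, 0 ≤ x → P x = Q x) (x : X) :
    P x = Q x := by
  rw [← posPart_sub_negPart x, map_sub, map_sub, h _ (posPart_nonneg x), h _ (negPart_nonneg x)]

theorem Riesz.IsBandProjection.isOrderProj {P : X →ₗ[ℝ] X} (hP : IsBandProjection P) :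
    IsOrderProj P := by
  obtain ⟨B, hB⟩ := hP
  have hdisj : ∀ x, |P x| ⊓ |x - P x| = 0 := fun x => by
    rw [inf_comm]; exact (hB x).2 _ (hB x).1
  refine ⟨fun x => ?_, fun x hx => ?_, fun x hx => ?_⟩
  · have h := (hB (P x)).2 _ (B.toSubmodule.sub_mem (hB x).1 (hB (P x)).1)
    rw [inf_idem] at h
    have h' : P x - P (P x) = 0 := le_antisymm ((le_abs_self _).trans h.le)
      (neg_nonpos.1 ((neg_le_abs _).trans h.le))
    exact (sub_eq_zero.1 h').symm
  · exact nonneg_of_add_nonneg_of_abs_inf_abs_eq_zero (b := x - P x) (by simpa using hx) (hdisj x)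
  · rw [← sub_nonneg]
    exact nonneg_of_add_nonneg_of_abs_inf_abs_eq_zero (b := P x) (by simpa using hx)
      (by rw [inf_comm]; exact hdisj x)

namespace IsOrderProj

variable {P Q : X →ₗ[ℝ] X}

theorem mono (hP : IsOrderProj P) {x y : X} (h : x ≤ y) : P x ≤ P y := by
  rw [← sub_nonneg, ← map_sub]
  exact hP.nonneg _ (sub_nonneg.2 h)

theorem compl (hP : IsOrderProj P) : IsOrderProj (LinearMap.id - P) where
  idem x := by simp [hP.idem]
  nonneg x hx := by simpa using hP.le_self x hx
  le_self x hx := by simpa using hP.nonneg x hx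

theorem map_eq_zero_of_le (hP : IsOrderProj P) {x y : X} (hy : 0 ≤ y) (hyx : y ≤ x)
    (hx : P x = 0) : P y = 0 :=
  le_antisymm ((hP.mono hyx).trans hx.le) (hP.nonneg y hy)

theorem map_eq_self_of_le (hP : IsOrderProj P) {x y : X} (hy : 0 ≤ y) (hyx : y ≤ x)
    (hx : P x = x) : P y = y := by
  have h := hP.compl.map_eq_zero_of_le hy hyx (by simp [hx])
  exact (sub_eq_zero.1 h).symm

theorem inf_eq_zero (hP : IsOrderProj P) {x y : X} (hx : 0 ≤ x) (hy : 0 ≤ y) (hPx : P x = x)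
    (hPy : P y = 0) : x ⊓ y = 0 := by
  have h := le_inf hx hy
  rw [← hP.map_eq_self_of_le h inf_le_left hPx]
  exact hP.map_eq_zero_of_le h inf_le_right hPy

theorem map_posPart_eq_zero (hP : IsOrderProj P) {x : X} (hx : P x ≤ 0) : P x⁺ = 0 := by
  have h₀ := hP.nonneg _ (posPart_nonneg x)
  have h : P x⁺ ≤ P x⁻ := by
    rwa [← posPart_sub_negPart x, map_sub, sub_nonpos] at hx
  refine le_antisymm ?_ h₀
  rw [← posPart_inf_negPart_eq_zero x]
  exact le_inf (hP.le_self _ (posPart_nonneg x)) (h.trans (hP.le_self _ (negPart_nonneg x)))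

/-- Band projections commute. -/
theorem commute (hP : IsOrderProj P) (hQ : IsOrderProj Q) (x : X) : P (Q x) = Q (P x) := by
  refine LinearMap.eq_of_forall_nonneg (P := P ∘ₗ Q) (Q := Q ∘ₗ P) (fun x hx => ?_) x
  have h₁ : Q (P (Q x)) = P (Q x) := hQ.map_eq_self_of_le (hP.nonneg _ (hQ.nonneg _ hx))
    (hP.le_self _ (hQ.nonneg _ hx)) (hQ.idem x)
  have h₂ : Q (P (x - Q x)) = 0 := hQ.map_eq_zero_of_le
    (hP.nonneg _ (sub_nonneg.2 (hQ.le_self x hx))) (hP.le_self _ (sub_nonneg.2 (hQ.le_self x hx)))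
    (by simp [hQ.idem])
  rw [map_sub, map_sub, h₁, sub_eq_zero] at h₂
  exact h₂.symm

theorem comp (hP : IsOrderProj P) (hQ : IsOrderProj Q) : IsOrderProj (P ∘ₗ Q) where
  idem x := by
    simp only [LinearMap.comp_apply]
    rw [hQ.commute hP, hQ.idem, hP.idem]
  nonneg x hx := hP.nonneg _ (hQ.nonneg x hx)
  le_self x hx := (hP.le_self _ (hQ.nonneg x hx)).trans (hQ.le_self x hx)

theorem eq_zero_of_map_unit_eq_zero (hP : IsOrderProj P) {e : X} (he : IsWeakOrderUnit e)
    (h : P e = 0) (x : X) : P x = 0 := by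
  refine LinearMap.eq_of_forall_nonneg (P := P) (Q := 0) (fun x hx => ?_) x
  exact he.2 _ (hP.nonneg x hx) (hP.inf_eq_zero (hP.nonneg x hx) he.1 (hP.idem x) h)

end IsOrderProj

theorem Riesz.BandProj.isOrderProj (P : BandProj X) : IsOrderProj P.toMap :=
  P.isBandProjection.isOrderProj

end OrderProjection

section Existence

theorem smul_le_abs_smul_abs {X : Type*} [AddCommGroup X] [Module ℝ X] [Lattice X]
    [IsOrderedAddMonoid X] [IsOrderedModule ℝ X] (r : ℝ) (x : X) : r • x ≤ |r| • |x| := by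
  rcases le_total 0 r with hr | hr
  · rw [abs_of_nonneg hr]; exact smul_le_smul_of_nonneg_left (le_abs_self x) hr
  · rw [abs_of_nonpos hr, ← neg_smul_neg r x]
    exact smul_le_smul_of_nonneg_left (neg_le_abs x) (neg_nonneg.2 hr)

/-- The disjoint complement `{x | |x| ∧ |f| = 0 for all f ∈ F}` of a set `F`, as a band. -/
def disjointBand {X : Type*} [AddCommGroup X] [Module ℝ X] [ConditionallyCompleteLattice X]
    [IsOrderedAddMonoid X] [IsOrderedModule ℝ X] (F : Set X) : Band X where
  carrier := {x | ∀ f ∈ F, |x| ⊓ |f| = 0}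
  zero_mem' f _ := by simp
  add_mem' {x y} hx hy f hf := inf_eq_zero_of_le (abs_nonneg _) (abs_add_le x y) (abs_nonneg _)
    (add_inf_eq_zero (abs_nonneg _) (abs_nonneg _) (abs_nonneg _) (hx f hf) (hy f hf))
  smul_mem' r x hx f hf := by
    obtain ⟨n, hn⟩ := exists_nat_ge |r|
    have h : |r| • |x| ≤ n • |x| := by
      rw [← Nat.cast_smul_eq_nsmul ℝ]
      exact smul_le_smul_of_nonneg_right hn (abs_nonneg x)
    refine inf_eq_zero_of_le (abs_nonneg _) (sup_le ((smul_le_abs_smul_abs r x).trans h) ?_)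
      (abs_nonneg _) (nsmul_inf_eq_zero (abs_nonneg x) (abs_nonneg _) (hx f hf) n)
    have h' := smul_le_abs_smul_abs (-r) x
    rw [abs_neg, neg_smul] at h'
    exact h'.trans h
  solid x y hx hyx f hf := inf_eq_zero_of_le (abs_nonneg _) hyx (abs_nonneg _) (hx f hf)
  sup_mem S m hS hm f hf := by
    have hneg : m⁻ ⊓ |f| = 0 := by
      rcases S.eq_empty_or_nonempty with rfl | ⟨s, hs⟩
      · -- An upper bound of `∅` that is least lies below `-|f|`, which forces `|f| = 0`.
        have h₁ : m ≤ m - |f| := hm.2 (by simp)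
        have h₂ : |f| = 0 := le_antisymm (by simpa using h₁) (abs_nonneg f)
        rw [h₂]
        exact inf_eq_right.2 (negPart_nonneg m)
      · exact inf_eq_zero_of_le (negPart_nonneg m)
          ((negPart_anti (hm.1 hs)).trans (negPart_le_abs_self s)) (abs_nonneg f) (hS hs f hf)
    have hpos : m⁺ ⊓ |f| = 0 := by
      have h₁ : |f| ⊓ m ≤ 0 := inf_le_of_isLUB hm fun s hs => by
        rw [← hS hs f hf, inf_comm]
        exact inf_le_inf_right _ (le_abs_self s)
      let _ := AddCommGroup.toDistribLattice X
      rw [posPart_def, inf_comm, inf_sup_left, inf_eq_right.2 (abs_nonneg f)]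
      exact sup_eq_right.2 h₁
    rw [← posPart_add_negPart]
    exact add_inf_eq_zero (posPart_nonneg m) (negPart_nonneg m) (abs_nonneg f) hpos hneg

variable {X : Type*} [AddCommGroup X] [Module ℝ X] [ConditionallyCompleteLattice X]
    [IsOrderedAddMonoid X] [IsOrderedModule ℝ X]

theorem mem_disjointBand {F : Set X} {x : X} :
    x ∈ (disjointBand F).toSubmodule ↔ ∀ f ∈ F, |x| ⊓ |f| = 0 := Iff.rfl

theorem mem_compl_iff {B : Band X} {x : X} :
    x ∈ B.compl ↔ x ∈ (disjointBand (B.toSubmodule : Set X)).toSubmodule := Iff.rfl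

/-- In a Dedekind complete Riesz space every band is a projection band. -/
theorem Riesz.Band.exists_bandProj (B : Band X) :
    ∃ Q : BandProj X, ∀ x, Q.toMap x ∈ B.toSubmodule ∧ x - Q.toMap x ∈ B.compl := by
  have hle : ∀ {x y : X}, y ∈ B.toSubmodule → 0 ≤ x → x ≤ y → x ∈ B.toSubmodule :=
    fun hy hx hxy => B.solid _ _ hy (by rwa [abs_of_nonneg hx, abs_of_nonneg (hx.trans hxy)])
  have hsplit : ∀ x : X, 0 ≤ x →
      x ∈ B.toSubmodule ⊔ (disjointBand (B.toSubmodule : Set X)).toSubmodule := by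
    intro x hx
    set S : Set X := {z | z ∈ B.toSubmodule ∧ z ≤ x} with hSdef
    have hS : IsLUB S (sSup S) :=
      isLUB_csSup ⟨0, B.toSubmodule.zero_mem, hx⟩ ⟨x, fun z hz => hz.2⟩
    have hmem : sSup S ∈ B.toSubmodule := B.sup_mem S _ (fun z hz => hz.1) hS
    have hSx : sSup S ≤ x := hS.2 fun z hz => hz.2
    refine Submodule.mem_sup.2 ⟨sSup S, hmem, x - sSup S, ?_, by abel⟩
    rintro b hb
    rw [abs_of_nonneg (sub_nonneg.2 hSx)]
    -- The meet lies in `B` and can be added to `sSup S` without leaving `S`.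
    have hz : (x - sSup S) ⊓ |b| ∈ B.toSubmodule := by
      refine B.solid b _ hb ?_
      rw [abs_of_nonneg (le_inf (sub_nonneg.2 hSx) (abs_nonneg b))]
      exact inf_le_right
    have h : sSup S + (x - sSup S) ⊓ |b| ≤ sSup S := hS.1
      ⟨B.toSubmodule.add_mem hmem hz, (add_le_add_right inf_le_left _).trans (by simp)⟩
    exact le_antisymm (by simpa using h) (le_inf (sub_nonneg.2 hSx) (abs_nonneg b))
  have hc : IsCompl B.toSubmodule (disjointBand (B.toSubmodule : Set X)).toSubmodule := by
    refine ⟨Submodule.disjoint_def.2 fun x hx hx' => ?_,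
      codisjoint_iff.2 (eq_top_iff.2 fun x _ => ?_)⟩
    · have h := hx' x hx
      rw [inf_idem] at h
      exact le_antisymm ((le_abs_self _).trans h.le) (neg_nonpos.1 ((neg_le_abs _).trans h.le))
    · rw [← posPart_sub_negPart x]
      exact Submodule.sub_mem _ (hsplit _ (posPart_nonneg x)) (hsplit _ (negPart_nonneg x))
  have key : ∀ x, Submodule.projection _ _ hc x ∈ B.toSubmodule ∧
      x - Submodule.projection _ _ hc x ∈ B.compl := fun x => by
    refine ⟨Submodule.projection_apply_mem hc x, ?_⟩
    rw [mem_compl_iff, ← Submodule.projection_apply_eq_zero_iff hc, map_sub,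
      Submodule.projection_apply_of_mem_left hc (Submodule.projection_apply_mem hc x), sub_self]
  exact ⟨⟨Submodule.projection _ _ hc, B, key⟩, key⟩

theorem map_eq_self_iff_mem {X : Type*} [AddCommGroup X] [Module ℝ X] [Lattice X]
    [IsOrderedAddMonoid X] {B : Band X} {Q : X →ₗ[ℝ] X}
    (hQ : ∀ x, Q x ∈ B.toSubmodule ∧ x - Q x ∈ B.compl) {x : X} :
    Q x = x ↔ x ∈ B.toSubmodule := by
  refine ⟨fun h => h ▸ (hQ x).1, fun h => ?_⟩
  have h' := (hQ x).2 _ (B.toSubmodule.sub_mem h (hQ x).1)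
  rw [inf_idem] at h'
  exact (sub_eq_zero.1 (le_antisymm ((le_abs_self _).trans h'.le)
    (neg_nonpos.1 ((neg_le_abs _).trans h'.le)))).symm

/-- The band projection onto the disjoint complement of a set of positive elements. -/
theorem exists_bandProj_disjoint (F : Set X) (hF : ∀ f ∈ F, 0 ≤ f) :
    ∃ D : BandProj X, ∀ x, 0 ≤ x → (D.toMap x = x ↔ ∀ f ∈ F, x ⊓ f = 0) := by
  obtain ⟨D, hD⟩ := (disjointBand F).exists_bandProj
  refine ⟨D, fun x hx => ?_⟩
  rw [map_eq_self_iff_mem hD, mem_disjointBand]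
  refine forall₂_congr fun f hf => ?_
  rw [abs_of_nonneg hx, abs_of_nonneg (hF f hf)]

end Existence

/-! ### Conditional expectations and their fixed points -/

section ConditionalExpectation

namespace Riesz.IsConditionalExpectation

variable {X : Type*} [AddCommGroup X] [Module ℝ X] [ConditionallyCompleteLattice X]
  {T : X →ₗ[ℝ] X}

theorem map_nonneg (hT : IsConditionalExpectation T) {x : X} (hx : 0 ≤ x) : 0 ≤ T x := by
  rcases hx.eq_or_lt with rfl | h
  · simp
  · exact (hT.strictlyPositive x h).le

theorem eq_zero_of_map_nonpos (hT : IsConditionalExpectation T) {x : X} (hx : 0 ≤ x)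
    (h : T x ≤ 0) : x = 0 := by
  by_contra hne
  exact (hT.strictlyPositive x (lt_of_le_of_ne hx (Ne.symm hne))).not_ge h

theorem map_sup_eq (hT : IsConditionalExpectation T) {x y : X} (hx : T x = x) (hy : T y = y) :
    T (x ⊔ y) = x ⊔ y := by
  obtain ⟨z, hz⟩ := hT.range_sup x y
  rw [hx, hy] at hz
  rw [← hz, hT.idem]

theorem map_posPart_eq (hT : IsConditionalExpectation T) {x : X} (hx : T x = x) : T x⁺ = x⁺ :=
  hT.map_sup_eq hx (map_zero T)

variable [IsOrderedAddMonoid X]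

theorem mono (hT : IsConditionalExpectation T) {x y : X} (h : x ≤ y) : T x ≤ T y := by
  rw [← sub_nonneg, ← map_sub]
  exact hT.map_nonneg (sub_nonneg.2 h)

theorem map_inf_eq (hT : IsConditionalExpectation T) {x y : X} (hx : T x = x) (hy : T y = y) :
    T (x ⊓ y) = x ⊓ y := by
  have h : x ⊓ y = x + y - x ⊔ y := eq_sub_of_add_eq (inf_add_sup x y)
  rw [h, map_sub, map_add, hx, hy, hT.map_sup_eq hx hy]

theorem isGLB_range (hT : IsConditionalExpectation T) {f : ℕ → X} (hf : Antitone f) {a : X}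
    (ha : IsGLB (Set.range f) a) : IsGLB (Set.range fun n => T (f n)) (T a) := by
  have h := hT.orderContinuous (Set.range fun n => f n - a) (Set.range_nonempty _) ?_ ?_
  · refine ⟨by rintro _ ⟨n, rfl⟩; exact hT.mono (ha.1 ⟨n, rfl⟩), fun b hb => ?_⟩
    refine sub_nonpos.1 (h.2 ?_)
    rintro _ ⟨_, ⟨n, rfl⟩, rfl⟩
    rw [map_sub]
    exact sub_le_sub_right (hb ⟨n, rfl⟩) _
  · rintro _ ⟨m, rfl⟩ _ ⟨n, rfl⟩
    exact ⟨_, ⟨max m n, rfl⟩, sub_le_sub_right (hf (le_max_left m n)) _,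
      sub_le_sub_right (hf (le_max_right m n)) _⟩
  · refine ⟨by rintro _ ⟨n, rfl⟩; exact sub_nonneg.2 (ha.1 ⟨n, rfl⟩), fun b hb => ?_⟩
    have h₁ : b + a ≤ a := ha.2 (by
      rintro _ ⟨n, rfl⟩
      exact le_sub_iff_add_le.1 (hb ⟨n, rfl⟩))
    simpa using h₁

theorem isLUB_range (hT : IsConditionalExpectation T) {f : ℕ → X} (hf : Monotone f) {a : X}
    (ha : IsLUB (Set.range f) a) : IsLUB (Set.range fun n => T (f n)) (T a) := by
  have h := hT.isGLB_range (f := fun n => -f n) (a := -a) (fun m n h => neg_le_neg (hf h))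
    ⟨by rintro _ ⟨n, rfl⟩; exact neg_le_neg (ha.1 ⟨n, rfl⟩), fun b hb =>
      le_neg.1 (ha.2 (by rintro _ ⟨n, rfl⟩; exact le_neg.1 (hb ⟨n, rfl⟩)))⟩
  refine ⟨by rintro _ ⟨n, rfl⟩; exact hT.mono (ha.1 ⟨n, rfl⟩), fun b hb => ?_⟩
  rw [← neg_le_neg_iff, ← map_neg]
  refine h.2 ?_
  rintro _ ⟨n, rfl⟩
  simpa using hb ⟨n, rfl⟩

theorem map_eq_of_isLUB (hT : IsConditionalExpectation T) {f : ℕ → X} (hf : Monotone f)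
    (hTf : ∀ n, T (f n) = f n) {a : X} (ha : IsLUB (Set.range f) a) : T a = a := by
  have h := hT.isLUB_range hf ha
  simp only [hTf] at h
  exact h.unique ha

theorem map_eq_of_isGLB (hT : IsConditionalExpectation T) {f : ℕ → X} (hf : Antitone f)
    (hTf : ∀ n, T (f n) = f n) {a : X} (ha : IsGLB (Set.range f) a) : T a = a := by
  have h := hT.isGLB_range hf ha
  simp only [hTf] at h
  exact h.unique ha

/-- A band projection commutes with `T` as soon as `T` fixes the component of `e` it selects. -/
theorem commute_of_map_unit (hT : IsConditionalExpectation T) {e : X} (he : IsWeakOrderUnit e)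
    (hTe : T e = e) {D : X →ₗ[ℝ] X} (hD : IsOrderProj D) (hTD : T (D e) = D e) (x : X) :
    T (D x) = D (T x) := by
  have key : ∀ {D : X →ₗ[ℝ] X}, IsOrderProj D → T (D e) = D e → ∀ x, 0 ≤ x → D x = x →
      D (T x) = T x := by
    intro D hD hTD x hx hDx
    refine le_antisymm (hD.le_self _ (hT.map_nonneg hx)) ?_
    have hmono : Monotone fun n : ℕ => x ⊓ n • e :=
      fun i j hij => inf_le_inf_left x (nsmul_le_nsmul_left he.1 hij)
    refine (hT.isLUB_range hmono (isLUB_inf_nsmul he x)).2 ?_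
    rintro _ ⟨n, rfl⟩
    have h₀ : 0 ≤ x ⊓ n • e := le_inf hx (nsmul_nonneg he.1 n)
    have h₁ : x ⊓ n • e ≤ n • D e := by
      rw [← hD.map_eq_self_of_le h₀ inf_le_left hDx, ← map_nsmul]
      exact hD.mono inf_le_right
    have h₂ : D (T (x ⊓ n • e)) = T (x ⊓ n • e) :=
      hD.map_eq_self_of_le (hT.map_nonneg h₀) ((hT.mono h₁).trans_eq (by rw [map_nsmul, hTD]))
        (by rw [map_nsmul, hD.idem])
    change T (x ⊓ n • e) ≤ _
    rw [← h₂]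
    exact hD.mono (hT.mono inf_le_left)
  refine LinearMap.eq_of_forall_nonneg (P := T ∘ₗ D) (Q := D ∘ₗ T) (fun x hx => ?_) x
  have h₁ := key hD hTD (D x) (hD.nonneg x hx) (hD.idem x)
  have h₂ := key hD.compl (by simp [hTe, hTD]) (x - D x) (sub_nonneg.2 (hD.le_self x hx))
    (by simp [hD.idem])
  have h₃ : D (T (x - D x)) = 0 := by simpa using h₂
  rw [map_sub, map_sub, h₁, sub_eq_zero] at h₃
  exact h₃.symm

/-- The projection onto the disjoint complement of an increasing sequence fixed by `T` commutes
with `T`. -/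
theorem commute_of_disjoint (hT : IsConditionalExpectation T) {e : X} (he : IsWeakOrderUnit e)
    (hTe : T e = e) {f : ℕ → X} (hf : Monotone f) (hf₀ : ∀ n, 0 ≤ f n) (hTf : ∀ n, T (f n) = f n)
    {D : X →ₗ[ℝ] X} (hD : IsOrderProj D) (hDf : ∀ x, 0 ≤ x → (D x = x ↔ ∀ n, x ⊓ f n = 0))
    (x : X) :
    T (D x) = D (T x) := by
  refine hT.commute_of_map_unit he hTe hD ?_ x
  -- The component of `e` in the band generated by the `fₙ` is `a = supₙ (e ∧ n fₙ)`.
  set a := sSup (Set.range fun n : ℕ => e ⊓ n • f n) with ha_def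
  have ha : IsLUB (Set.range fun n : ℕ => e ⊓ n • f n) a :=
    isLUB_csSup (Set.range_nonempty _) ⟨e, by rintro _ ⟨n, rfl⟩; exact inf_le_left⟩
  have hmono : Monotone fun n : ℕ => e ⊓ n • f n := fun i j hij => inf_le_inf_left e
    ((nsmul_le_nsmul_right (hf hij) i).trans (nsmul_le_nsmul_left (hf₀ j) hij))
  have hTa : T a = a := hT.map_eq_of_isLUB hmono
    (fun n => hT.map_inf_eq hTe (by rw [map_nsmul, hTf])) ha
  have hDfn : ∀ n, D (f n) = 0 := fun n => by
    have h := (hDf _ (hD.nonneg _ (hf₀ n))).1 (hD.idem (f n)) n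
    rwa [inf_eq_left.2 (hD.le_self _ (hf₀ n))] at h
  have hale : a ≤ e - D e := ha.2 (by
    rintro _ ⟨n, rfl⟩
    have h₀ : 0 ≤ e ⊓ n • f n := le_inf he.1 (nsmul_nonneg (hf₀ n) n)
    have h := hD.compl.mono (inf_le_left : e ⊓ n • f n ≤ e)
    have h' := hD.map_eq_zero_of_le h₀ inf_le_right (by rw [map_nsmul, hDfn, nsmul_zero])
    simpa [h'] using h)
  have ht₀ : 0 ≤ e - D e - a := sub_nonneg.2 hale
  have hDt : D (e - D e - a) = e - D e - a := (hDf _ ht₀).2 fun n =>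
    inf_eq_zero_of_le ht₀ (sub_le_sub_right (sub_le_self _ (hD.nonneg e he.1)) a) (hf₀ n)
      (sub_inf_eq_zero_of_isLUB hf hf₀ ha n)
  have ha₀ : 0 ≤ a := by simpa using ha.1 ⟨0, rfl⟩ |>.trans' (by simp [he.1])
  have ht : e - D e - a = 0 := by
    rw [← hDt]
    exact hD.map_eq_zero_of_le (x := e - D e) ht₀ (sub_le_self _ ha₀) (by simp [hD.idem])
  have hDe : D e = e - a := by rw [← sub_eq_zero, ← neg_eq_zero, ← ht]; abel
  rw [hDe, map_sub, hTe, hTa]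

end Riesz.IsConditionalExpectation

end ConditionalExpectation

/-! ### The divergence part of an increasing sequence -/

section Divergence

variable {X : Type*} [AddCommGroup X] [Module ℝ X] [ConditionallyCompleteLattice X]

/-- `Q` projects onto the part of `X` on which the increasing sequence `s` is infinite: the positive
elements in its range are those with no nonzero part on which `s` is bounded by a multiple `m e`
of the unit, that is, no nonzero part disjoint from all `(sₙ - m e)⁺`. -/
def IsDivergenceProj (s : ℕ → X) (e : X) (Q : X →ₗ[ℝ] X) : Prop :=
  ∀ x, 0 ≤ x → (Q x = x ↔ ∀ (m : ℕ) (z : X), 0 ≤ z → z ≤ x →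
    (∀ n, z ⊓ (s n - m • e)⁺ = 0) → z = 0)

/-- `D` projects onto the part of `X` on which the sequence `s` is bounded by `m e`. -/
def IsLevelProj (s : ℕ → X) (e : X) (m : ℕ) (D : X →ₗ[ℝ] X) : Prop :=
  ∀ x, 0 ≤ x → (D x = x ↔ ∀ n, x ⊓ (s n - m • e)⁺ = 0)

variable {s : ℕ → X} {e : X} {Q D : X →ₗ[ℝ] X} {m : ℕ}

theorem IsLevelProj.map_posPart (hDl : IsLevelProj s e m D) (hD : IsOrderProj D) (n : ℕ) :
    D (s n - m • e)⁺ = 0 := by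
  have h := (hDl _ (hD.nonneg _ (posPart_nonneg (s n - m • e)))).1 (hD.idem _) n
  rwa [inf_eq_left.2 (hD.le_self _ (posPart_nonneg _))] at h

theorem IsDivergenceProj.comp_levelProj (hQ : IsDivergenceProj s e Q)
    (hDl : IsLevelProj s e m D) (hD : IsOrderProj D) {x : X} (hx : 0 ≤ x) (hQx : Q x = x) :
    D x = 0 := by
  have h₀ := hD.nonneg x hx
  exact (hQ x hx).1 hQx m _ h₀ (hD.le_self x hx) ((hDl _ h₀).1 (hD.idem x))

variable [IsOrderedAddMonoid X]

theorem exists_isLevelProj [IsOrderedModule ℝ X] (s : ℕ → X) (e : X) (m : ℕ) :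
    ∃ D : BandProj X, IsLevelProj s e m D.toMap := by
  obtain ⟨D, hD⟩ := exists_bandProj_disjoint (Set.range fun n => (s n - m • e)⁺)
    (by rintro _ ⟨n, rfl⟩; exact posPart_nonneg _)
  exact ⟨D, fun x hx => (hD x hx).trans (by simp)⟩

theorem IsLevelProj.map_le (hDl : IsLevelProj s e m D) (hD : IsOrderProj D) (n : ℕ) :
    D (s n) ≤ m • D e := by
  have h := hD.mono (le_posPart (s n - m • e))
  rwa [hDl.map_posPart hD, map_sub, map_nsmul, sub_nonpos] at h

theorem IsDivergenceProj.map_eq_self (hQ : IsDivergenceProj s e Q) {D : ℕ → X →ₗ[ℝ] X}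
    (hDl : ∀ m, IsLevelProj s e m (D m)) (hD : ∀ m, IsOrderProj (D m)) {x : X} (hx : 0 ≤ x)
    (h : ∀ m, D m x = 0) : Q x = x :=
  (hQ x hx).2 fun m z hz hzx hzs => by
    rw [← (hDl m z hz).2 hzs]
    exact (hD m).map_eq_zero_of_le hz hzx (h m)

variable {T : X →ₗ[ℝ] X}

theorem IsLevelProj.commute (hDl : IsLevelProj s e m D) (hD : IsOrderProj D)
    (hT : IsConditionalExpectation T) (he : IsWeakOrderUnit e) (hTe : T e = e) (hs : Monotone s)
    (hTs : ∀ n, T (s n) = s n) (x : X) : T (D x) = D (T x) :=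
  hT.commute_of_disjoint he hTe (f := fun n => (s n - m • e)⁺)
    (fun i j hij => posPart_mono (sub_le_sub_right (hs hij) _)) (fun n => posPart_nonneg _)
    (fun n => hT.map_posPart_eq (by rw [map_sub, map_nsmul, hTs, hTe])) hD hDl x

theorem IsLevelProj.map_eq_self_mono (he : 0 ≤ e) {D' : X →ₗ[ℝ] X} {m' : ℕ} (hmm : m ≤ m')
    (hDl : IsLevelProj s e m D) (hDl' : IsLevelProj s e m' D') {x : X} (hx : 0 ≤ x)
    (h : D x = x) : D' x = x :=
  (hDl' x hx).2 fun n => by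
    rw [inf_comm]
    refine inf_eq_zero_of_le (posPart_nonneg _)
      (posPart_mono (sub_le_sub_left (nsmul_le_nsmul_left he hmm) (s n))) hx ?_
    rw [inf_comm]
    exact (hDl x hx).1 h n

/-- The divergence part of a sequence fixed by `T` commutes with `T`: its complement is the
supremum of the level projections. -/
theorem IsDivergenceProj.commute [IsOrderedModule ℝ X] (hQ : IsDivergenceProj s e Q)
    (hQ' : IsOrderProj Q) (hT : IsConditionalExpectation T) (he : IsWeakOrderUnit e)
    (hTe : T e = e) (hs : Monotone s) (hTs : ∀ n, T (s n) = s n) (x : X) : T (Q x) = Q (T x) := by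
  choose D hDl using fun m => exists_isLevelProj s e m
  have hD : ∀ m, IsOrderProj (D m).toMap := fun m => (D m).isOrderProj
  refine hT.commute_of_map_unit he hTe hQ' ?_ x
  have hmono : Monotone fun m => (D m).toMap e := fun i j hij => by
    have h₀ := (hD i).nonneg e he.1
    change (D i).toMap e ≤ (D j).toMap e
    rw [← (hDl i).map_eq_self_mono he.1 hij (hDl j) h₀ ((hD i).idem e)]
    exact (hD j).mono ((hD i).le_self e he.1)
  have ha : IsLUB (Set.range fun m => (D m).toMap e) (sSup (Set.range fun m => (D m).toMap e)) :=
    isLUB_csSup (Set.range_nonempty _)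
      ⟨e, by rintro _ ⟨m, rfl⟩; exact (hD m).le_self e he.1⟩
  set a := sSup (Set.range fun m => (D m).toMap e) with ha_def
  have hTa : T a = a := hT.map_eq_of_isLUB hmono
    (fun m => by rw [(hDl m).commute (hD m) hT he hTe hs hTs, hTe]) ha
  have hle : a ≤ e - Q e := ha.2 (by
    rintro _ ⟨m, rfl⟩
    have h₁ : (D m).toMap (Q e) = 0 :=
      hQ.comp_levelProj (hDl m) (hD m) (hQ'.nonneg e he.1) (hQ'.idem e)
    have h₂ : (D m).toMap (e - Q e) ≤ e - Q e :=
      (hD m).le_self _ (sub_nonneg.2 (hQ'.le_self e he.1))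
    rwa [map_sub, h₁, sub_zero] at h₂)
  have hr₀ : 0 ≤ e - Q e - a := sub_nonneg.2 hle
  have ha₀ : 0 ≤ a := ((hD 0).nonneg e he.1).trans (ha.1 ⟨0, rfl⟩)
  have hr : Q (e - Q e - a) = e - Q e - a := by
    refine hQ.map_eq_self hDl hD hr₀ fun m => le_antisymm ?_ ((hD m).nonneg _ hr₀)
    have h₁ : (D m).toMap (e - Q e - a) ≤ (D m).toMap (e - (D m).toMap e) :=
      (hD m).mono ((sub_le_sub_right (sub_le_self _ (hQ'.nonneg e he.1)) a).trans
        (sub_le_sub_left (ha.1 ⟨m, rfl⟩) e))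
    rwa [map_sub _ e, (hD m).idem, sub_self] at h₁
  have hr' : e - Q e - a = 0 := by
    rw [← hr]
    exact hQ'.map_eq_zero_of_le (x := e - Q e) hr₀ (sub_le_self _ ha₀) (by simp [hQ'.idem])
  have hQe : Q e = e - a := by rw [← sub_eq_zero, ← neg_eq_zero, ← hr']; abel
  rw [hQe, map_sub, hTe, hTa]

end Divergence

/-! ### The limit superior of band projections -/

section Limsup

variable {X : Type*} [AddCommGroup X] [Module ℝ X] [ConditionallyCompleteLattice X]
  [IsOrderedAddMonoid X] [IsOrderedModule ℝ X]

theorem Riesz.BandProj.exists_compl (K : BandProj X) :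
    ∃ R : BandProj X, ∀ x, R.toMap x = x - K.toMap x := by
  obtain ⟨B, hB⟩ := K.isBandProjection
  refine ⟨⟨LinearMap.id - K.toMap, disjointBand (B.toSubmodule : Set X), fun x =>
    ⟨(hB x).2, fun b hb => ?_⟩⟩, fun x => rfl⟩
  have h : x - (LinearMap.id - K.toMap : X →ₗ[ℝ] X) x = K.toMap x := by simp
  rw [h, inf_comm]
  exact hb _ (hB x).1

/-- The supremum of the tail `(P_k)_{k ≥ n}`, given as the complement of the projection `K` onto the
common kernel of the tail. -/
theorem exists_isLUB_tail (P : ℕ → BandProj X) (n : ℕ) :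
    ∃ R K : BandProj X, IsLUB (P '' Set.Ici n) R ∧ (∀ x, R.toMap x = x - K.toMap x) ∧
      ∀ x, 0 ≤ x → (K.toMap x = x ↔ ∀ k, n ≤ k → (P k).toMap x = 0) := by
  obtain ⟨K, hK⟩ := exists_bandProj_disjoint
    {f : X | ∃ k, n ≤ k ∧ ∃ y, 0 ≤ y ∧ f = (P k).toMap y}
    (by rintro _ ⟨k, _, y, hy, rfl⟩; exact (P k).isOrderProj.nonneg y hy)
  have hK' : ∀ x, 0 ≤ x → (K.toMap x = x ↔ ∀ k, n ≤ k → (P k).toMap x = 0) := by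
    intro x hx
    rw [hK x hx]
    constructor
    · intro h k hk
      have h' := h _ ⟨k, hk, x, hx, rfl⟩
      rwa [inf_eq_right.2 ((P k).isOrderProj.le_self x hx)] at h'
    · rintro h _ ⟨k, hk, y, hy, rfl⟩
      rw [inf_comm]
      exact (P k).isOrderProj.inf_eq_zero ((P k).isOrderProj.nonneg y hy) hx
        ((P k).isOrderProj.idem y) (h k hk)
  have hKK := K.isOrderProj
  obtain ⟨R, hRK⟩ := K.exists_compl
  have hPK : ∀ k, n ≤ k → ∀ x, 0 ≤ x → (P k).toMap (K.toMap x) = 0 := fun k hk x hx =>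
    (hK' _ (hKK.nonneg x hx)).1 (hKK.idem x) k hk
  refine ⟨R, K, ⟨?_, fun S hS x hx => ?_⟩, hRK, hK'⟩
  · rintro _ ⟨k, hk, rfl⟩ x hx
    have h := (P k).isOrderProj.le_self _ (sub_nonneg.2 (hKK.le_self x hx))
    rw [map_sub, hPK k hk x hx, sub_zero] at h
    rwa [hRK]
  · have hSS := S.isOrderProj
    have h₀ : 0 ≤ x - S.toMap x := sub_nonneg.2 (hSS.le_self x hx)
    have h₁ : R.toMap (x - S.toMap x) = 0 := by
      rw [hRK, (hK' _ h₀).2 fun k hk => ?_, sub_self]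
      refine le_antisymm ((hS ⟨k, hk, rfl⟩ _ h₀).trans ?_) ((P k).isOrderProj.nonneg _ h₀)
      simp [hSS.idem]
    rw [map_sub, sub_eq_zero] at h₁
    rw [h₁]
    exact R.isOrderProj.le_self _ (hSS.nonneg x hx)

end Limsup

/-! ### Independence -/

section Independence

variable {X : Type*} [AddCommGroup X] [Module ℝ X] [Lattice X] {T : X →ₗ[ℝ] X} {e : X}
  {P : ℕ → BandProj X}

/-- Independence is inherited by the complements `1 - P_k`, and even by mixed products. -/
theorem Riesz.TIndependent.mixed (hP : TIndependent T e P) (l l' : List ℕ) (h : (l ++ l').Nodup) :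
    T (((l.map fun k => ((P k).toMap : Module.End ℝ X)).prod *
        (l'.map fun k => (1 - (P k).toMap : Module.End ℝ X)).prod) e) =
      ((l.map fun k => (T * (P k).toMap : Module.End ℝ X)).prod *
        (l'.map fun k => (1 - T * (P k).toMap : Module.End ℝ X)).prod) e := by
  induction l' generalizing l with
  | nil => simpa using hP l (by simpa using h)
  | cons j l' ih =>
    have h₁ := ih l (h.sublist (List.Sublist.append_left (List.sublist_cons_self j l') l))
    have h₂ := ih (l ++ [j]) (by simpa using h)
    simp only [List.map_append, List.map_cons, List.map_nil, List.prod_append, List.prod_cons,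
      List.prod_nil, mul_one] at h₁ h₂ ⊢
    have h₃ : ∀ A B C : Module.End ℝ X, A * ((1 - B) * C) = A * C - A * B * C := by
      intro A B C; noncomm_ring
    rw [h₃, h₃, LinearMap.sub_apply, LinearMap.sub_apply, map_sub, h₁, h₂]

/-- `(1 - P_{n+i-1}) ⋯ (1 - P_n) e`, the part of `e` on which none of `P_n, …, P_{n+i-1}` is
active. -/
def noneOf (P : ℕ → BandProj X) (e : X) (n : ℕ) : ℕ → X
  | 0 => e
  | i + 1 => noneOf P e n i - (P (n + i)).toMap (noneOf P e n i)

theorem Riesz.TIndependent.map_noneOf_succ (hP : TIndependent T e P) (n i : ℕ) :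
    T (noneOf P e n (i + 1)) =
      T (noneOf P e n i) - T ((P (n + i)).toMap (T (noneOf P e n i))) := by
  have hlist : ∀ i, ((List.range i).map (n + ·)).reverse.Nodup := fun i =>
    List.nodup_reverse.2 (List.nodup_range.map (add_right_injective n))
  have hnone : ∀ i, noneOf P e n i = ((((List.range i).map (n + ·)).reverse.map
      fun k => (1 - (P k).toMap : Module.End ℝ X)).prod) e := by
    intro i
    induction i with
    | zero => simp [noneOf]
    | succ i ih => rw [noneOf, ih, List.range_succ]; simp
  have key : ∀ i, T (noneOf P e n i) = ((((List.range i).map (n + ·)).reverse.map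
      fun k => (1 - T * (P k).toMap : Module.End ℝ X)).prod) e := by
    intro i
    rw [hnone]
    have h := hP.mixed [] ((List.range i).map (n + ·)).reverse (hlist i)
    rwa [List.map_nil, List.map_nil, List.prod_nil, one_mul, one_mul] at h
  rw [key (i + 1), key i, List.range_succ]
  simp

end Independence

section BorelCantelli

variable {X : Type*} [AddCommGroup X] [Module ℝ X] [ConditionallyCompleteLattice X]
  {T : X →ₗ[ℝ] X} {e : X} {P : ℕ → BandProj X}

/-- The partial sums of `∑ T Pₙ e`. -/
def condSum (T : X →ₗ[ℝ] X) (e : X) (P : ℕ → BandProj X) (n : ℕ) : X :=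
  ∑ k ∈ Finset.range n, T ((P k).toMap e)

theorem map_condSum (hT : IsConditionalExpectation T) (n : ℕ) :
    T (condSum T e P n) = condSum T e P n := by
  simp only [condSum, map_sum, hT.idem]

variable [IsOrderedAddMonoid X]

theorem noneOf_nonneg (he : 0 ≤ e) (P : ℕ → BandProj X) (n i : ℕ) :
    0 ≤ noneOf P e n i := by
  induction i with
  | zero => exact he
  | succ i ih => exact sub_nonneg.2 ((P (n + i)).isOrderProj.le_self _ ih)

theorem map_unit_le_noneOf {K : BandProj X} {n : ℕ}
    (hK : ∀ k, n ≤ k → (P k).toMap (K.toMap e) = 0) (he : 0 ≤ e) (i : ℕ) :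
    K.toMap e ≤ noneOf P e n i := by
  induction i with
  | zero => exact K.isOrderProj.le_self e he
  | succ i ih =>
    have h := (P (n + i)).isOrderProj.le_self _ (sub_nonneg.2 ih)
    rw [map_sub, hK _ (Nat.le_add_right n i), sub_zero] at h
    rw [noneOf, le_sub_comm]
    exact h

theorem condSum_mono (hT : IsConditionalExpectation T) (he : 0 ≤ e) : Monotone (condSum T e P) :=
  monotone_nat_of_le_succ fun n => by
    rw [condSum, condSum, Finset.sum_range_succ]
    exact le_add_of_nonneg_right (hT.map_nonneg ((P n).isOrderProj.nonneg e he))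

theorem condSum_le (hT : IsConditionalExpectation T) (he : 0 ≤ e) (hTe : T e = e) (n : ℕ) :
    condSum T e P n ≤ n • e := by
  have h : ∀ k ∈ Finset.range n, T ((P k).toMap e) ≤ e := fun k _ =>
    (hT.mono ((P k).isOrderProj.le_self e he)).trans_eq hTe
  simpa [condSum] using Finset.sum_le_card_nsmul _ _ _ h

/-- **First Borel–Cantelli lemma.** A band projection below every tail supremum vanishes wherever
the sum is bounded, since there the remainders of the sum decrease to `0`. -/
theorem map_level_eq_zero_of_le_tail (hT : IsConditionalExpectation T) (he : IsWeakOrderUnit e)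
    (hTe : T e = e) {R K : ℕ → BandProj X} (hRK : ∀ n x, (R n).toMap x = x - (K n).toMap x)
    (hK : ∀ n x, 0 ≤ x → ((K n).toMap x = x ↔ ∀ k, n ≤ k → (P k).toMap x = 0))
    {S : BandProj X} (hS : ∀ n, S ≤ R n) {m : ℕ} {D : BandProj X}
    (hD : IsLevelProj (condSum T e P) e m D.toMap) (x : X) : D.toMap (S.toMap x) = 0 := by
  have hDD := D.isOrderProj
  have hs : Monotone (condSum T e P) := condSum_mono hT he.1
  have hTD := hD.commute hDD hT he hTe hs (map_condSum hT)
  refine (hDD.comp S.isOrderProj).eq_zero_of_map_unit_eq_zero he ?_ x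
  change D.toMap (S.toMap e) = 0
  have hσ : IsLUB (Set.range fun n => D.toMap (condSum T e P n))
      (sSup (Set.range fun n => D.toMap (condSum T e P n))) :=
    isLUB_csSup (Set.range_nonempty _)
      ⟨m • D.toMap e, by rintro _ ⟨n, rfl⟩; exact hD.map_le hDD n⟩
  set σ := sSup (Set.range fun n => D.toMap (condSum T e P n)) with hσ_def
  have hDe : 0 ≤ D.toMap e := hDD.nonneg e he.1
  have hsum : ∀ N i, 0 ≤ ∑ k ∈ Finset.Ico N (N + i), (P k).toMap e := fun N i =>
    Finset.sum_nonneg fun k _ => (P k).isOrderProj.nonneg e he.1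
  have htail : ∀ N, T (D.toMap (S.toMap e)) ≤ σ - D.toMap (condSum T e P N) := by
    intro N
    -- The truncated tail sums `b i` increase to an upper bound of the tail supremum on `D e`.
    set b : ℕ → X := fun i => D.toMap e ⊓ ∑ k ∈ Finset.Ico N (N + i), (P k).toMap e with hb_def
    have hb : Monotone b := monotone_nat_of_le_succ fun i => inf_le_inf_left _ (by
      rw [← add_assoc, Finset.sum_Ico_succ_top (Nat.le_add_right N i)]
      exact le_add_of_nonneg_right ((P (N + i)).isOrderProj.nonneg e he.1))
    have ha : IsLUB (Set.range b) (sSup (Set.range b)) := isLUB_csSup (Set.range_nonempty _)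
      ⟨D.toMap e, by rintro _ ⟨i, rfl⟩; exact inf_le_left⟩
    set a := sSup (Set.range b) with ha_def
    have ha₀ : 0 ≤ a := le_trans (by simp [hb_def, hDe]) (ha.1 ⟨0, rfl⟩)
    have hRR := (R N).isOrderProj
    have hRa : (R N).toMap (D.toMap e) ≤ a := by
      have ht₀ := posPart_nonneg ((R N).toMap (D.toMap e) - a)
      have hPt : ∀ k, N ≤ k → (P k).toMap ((R N).toMap (D.toMap e) - a)⁺ = 0 := by
        intro k hk
        have hPk := (P k).isOrderProj
        refine hPk.map_posPart_eq_zero ?_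
        have h₁ : (P k).toMap (D.toMap e) ≤ a := by
          refine le_trans (le_inf (hPk.le_self _ hDe) ?_) (ha.1 ⟨k - N + 1, rfl⟩)
          refine (hPk.mono (hDD.le_self e he.1)).trans ?_
          exact Finset.single_le_sum (f := fun k => (P k).toMap e)
            (fun j _ => (P j).isOrderProj.nonneg e he.1) (Finset.mem_Ico.2 ⟨hk, by omega⟩)
        have h₂ := hPk.mono h₁
        rw [hPk.idem] at h₂
        rw [map_sub, sub_nonpos]
        exact (hPk.mono (hRR.le_self _ hDe)).trans h₂
      have h₁ : (R N).toMap ((R N).toMap (D.toMap e) - a)⁺ = 0 := by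
        rw [hRK, (hK N _ ht₀).2 hPt, sub_self]
      have h₂ : ((R N).toMap (D.toMap e) - a)⁺ ≤ (R N).toMap (D.toMap e) :=
        sup_le (sub_le_self _ ha₀) (hRR.nonneg _ hDe)
      rw [hRR.map_eq_self_of_le ht₀ h₂ (hRR.idem _)] at h₁
      exact sub_nonpos.1 (posPart_eq_zero.1 h₁)
    have hTa : T a ≤ σ - D.toMap (condSum T e P N) := by
      refine (hT.isLUB_range hb ha).2 ?_
      rintro _ ⟨i, rfl⟩
      have hb₀ : 0 ≤ b i := le_inf hDe (hsum N i)
      have h₁ : b i ≤ D.toMap (∑ k ∈ Finset.Ico N (N + i), (P k).toMap e) := by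
        rw [← hDD.map_eq_self_of_le hb₀ inf_le_left (hDD.idem e)]
        exact hDD.mono inf_le_right
      have h₂ : T (∑ k ∈ Finset.Ico N (N + i), (P k).toMap e) =
          condSum T e P (N + i) - condSum T e P N := by
        rw [condSum, condSum, ← Finset.sum_Ico_eq_sub _ (Nat.le_add_right N i), map_sum]
      refine (hT.mono h₁).trans ?_
      rw [hTD, h₂, map_sub]
      exact sub_le_sub_right (hσ.1 ⟨N + i, rfl⟩) _
    refine (hT.mono ?_).trans hTa
    rw [hDD.commute S.isOrderProj]
    exact (hS N _ hDe).trans hRa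
  have hσT : σ ≤ σ - T (D.toMap (S.toMap e)) := hσ.2 (by
    rintro _ ⟨N, rfl⟩
    exact le_sub_comm.1 (htail N))
  exact hT.eq_zero_of_map_nonpos (hDD.nonneg _ (S.isOrderProj.nonneg e he.1)) (by simpa using hσT)

variable [IsOrderedModule ℝ X]

/-- If `∑ T P_k y` is bounded by `e`, then `y ≥ 0` vanishes where `∑ T P_k e` is infinite:
on the band where `j y ≥ e` the sum `∑ T P_k e` is at most `(n + j) e`. -/
theorem IsDivergenceProj.map_eq_zero_of_sum_le (hT : IsConditionalExpectation T)
    (he : IsWeakOrderUnit e) (hTe : T e = e) {Q : X →ₗ[ℝ] X} (hQ' : IsOrderProj Q)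
    (hQ : IsDivergenceProj (condSum T e P) e Q) {y : X} (hy : 0 ≤ y) (hTy : T y = y) (n : ℕ)
    (hsum : ∀ i, ∑ k ∈ Finset.range i, T ((P (n + k)).toMap y) ≤ e) : Q y = 0 := by
  have hs : Monotone (condSum T e P) := condSum_mono hT he.1
  have hTQ := hQ.commute hQ' hT he hTe hs (map_condSum hT)
  refine le_antisymm (nonpos_of_forall_nsmul_le (b := e) fun j => ?_) (hQ'.nonneg y hy)
  set v := j • y - e with hv
  obtain ⟨D, hD⟩ := exists_bandProj_disjoint {v⁺} (by rintro _ rfl; exact posPart_nonneg v)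
  have hDD := D.isOrderProj
  have hTD := hT.commute_of_disjoint he hTe (f := fun _ => v⁺) monotone_const
    (fun _ => posPart_nonneg v)
    (fun _ => hT.map_posPart_eq (by rw [hv, map_sub, map_nsmul, hTy, hTe])) hDD
    (fun x hx => (hD x hx).trans (by simp))
  have hDpos : D.toMap v⁺ = 0 := by
    have h := (hD _ (hDD.nonneg _ (posPart_nonneg v))).1 (hDD.idem _) _ rfl
    rwa [inf_eq_left.2 (hDD.le_self _ (posPart_nonneg v))] at h
  have hDneg : D.toMap v⁻ = v⁻ := (hD _ (negPart_nonneg v)).2 (by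
    rintro _ rfl
    rw [inf_comm, posPart_inf_negPart_eq_zero])
  have hDv : D.toMap v = -v⁻ := by
    conv_lhs => rw [← posPart_sub_negPart v]
    rw [map_sub, hDpos, hDneg, zero_sub]
  -- `W` projects onto the part of the divergence band on which `j y ≥ e`.
  set W : X →ₗ[ℝ] X := Q ∘ₗ (LinearMap.id - D.toMap) with hW
  have hWW : IsOrderProj W := hQ'.comp hDD.compl
  have hTW : ∀ x, T (W x) = W (T x) := fun x => by simp [hW, hTQ, hTD]
  have hWe : W e ≤ j • W y := by
    have h : 0 ≤ W v := by
      have h₁ : (LinearMap.id - D.toMap : X →ₗ[ℝ] X) v = v⁺ := by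
        rw [LinearMap.sub_apply, hDv, LinearMap.id_apply, sub_neg_eq_add]
        exact (sub_eq_iff_eq_add.1 (posPart_sub_negPart v)).symm
      rw [hW, LinearMap.comp_apply, h₁]
      exact hQ'.nonneg _ (posPart_nonneg v)
    rwa [hv, map_sub, map_nsmul, sub_nonneg] at h
  have hterm : ∀ k, W (T ((P k).toMap e)) ≤ j • T ((P k).toMap y) := fun k => by
    have hPk := (P k).isOrderProj
    rw [← hTW, hWW.commute hPk, ← map_nsmul, ← map_nsmul]
    refine hT.mono (hPk.mono (hWe.trans ?_))
    exact nsmul_le_nsmul_right (hWW.le_self y hy) j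
  have hbound : ∀ i, W (condSum T e P i) ≤ (n + j) • e := by
    intro i
    have h₁ : condSum T e P i ≤ condSum T e P (n + i) := hs (Nat.le_add_left i n)
    have h₂ : condSum T e P (n + i) =
        condSum T e P n + ∑ k ∈ Finset.range i, T ((P (n + k)).toMap e) :=
      Finset.sum_range_add _ _ _
    refine (hWW.mono h₁).trans ?_
    rw [h₂, map_add, add_nsmul, map_sum]
    refine add_le_add ?_ ?_
    · exact (hWW.le_self _ (Finset.sum_nonneg fun k _ =>
        hT.map_nonneg ((P k).isOrderProj.nonneg e he.1))).trans (condSum_le hT he.1 hTe n)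
    · refine (Finset.sum_le_sum fun k _ => hterm (n + k)).trans ?_
      rw [← Finset.smul_sum]
      exact nsmul_le_nsmul_right (hsum i) j
  have hWe₀ : W e = 0 := by
    have h₀ := hWW.nonneg e he.1
    have hQW : Q (W e) = W e := by simp [hW, hQ'.idem]
    refine (hQ _ h₀).1 hQW (n + j) _ h₀ le_rfl fun i => ?_
    refine hWW.inf_eq_zero h₀ (posPart_nonneg _) (hWW.idem e) (hWW.map_posPart_eq_zero ?_)
    have h := hWW.mono (hbound i)
    rw [hWW.idem] at h
    rwa [map_sub, sub_nonpos]
  have hWv := hWW.eq_zero_of_map_unit_eq_zero he hWe₀ v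
  have hQv : Q v ≤ 0 := by
    have h : Q v = W v + Q (D.toMap v) := by simp [hW]
    rw [h, hWv, zero_add, hDv, map_neg, neg_nonpos]
    exact hQ'.nonneg _ (negPart_nonneg v)
  rw [hv, map_sub, map_nsmul, sub_nonpos] at hQv
  exact hQv.trans (hQ'.le_self e he.1)

/-- **Second Borel–Cantelli lemma.** The common kernel of a tail of an independent sequence is
disjoint from the band where `∑ T Pₖ e` is infinite. -/
theorem IsDivergenceProj.map_common_kernel_eq_zero (hT : IsConditionalExpectation T)
    (he : IsWeakOrderUnit e) (hTe : T e = e) (hP : TIndependent T e P) {Q : X →ₗ[ℝ] X}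
    (hQ' : IsOrderProj Q) (hQ : IsDivergenceProj (condSum T e P) e Q) {n : ℕ} {K : BandProj X}
    (hK : ∀ k, n ≤ k → (P k).toMap (K.toMap e) = 0) (x : X) : Q (K.toMap x) = 0 := by
  have hs : Monotone (condSum T e P) := condSum_mono hT he.1
  have hTQ := hQ.commute hQ' hT he hTe hs (map_condSum hT)
  set y : ℕ → X := fun i => T (noneOf P e n i) with hy_def
  have hy₀ : ∀ i, 0 ≤ y i := fun i => hT.map_nonneg (noneOf_nonneg he.1 P n i)
  have hterm₀ : ∀ i, 0 ≤ T ((P (n + i)).toMap (y i)) := fun i =>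
    hT.map_nonneg ((P (n + i)).isOrderProj.nonneg _ (hy₀ i))
  have hsucc : ∀ i, y (i + 1) = y i - T ((P (n + i)).toMap (y i)) := hP.map_noneOf_succ n
  have hy : Antitone y := antitone_nat_of_succ_le fun i => by
    rw [hsucc]; exact sub_le_self _ (hterm₀ i)
  have hsum : ∀ i, ∑ k ∈ Finset.range i, T ((P (n + k)).toMap (y k)) = e - y i := by
    intro i
    induction i with
    | zero => simp [hy_def, noneOf, hTe]
    | succ i ih => rw [Finset.sum_range_succ, ih, hsucc]; abel
  have ha : IsGLB (Set.range y) (sInf (Set.range y)) := isGLB_csInf (Set.range_nonempty _)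
    ⟨0, by rintro _ ⟨i, rfl⟩; exact hy₀ i⟩
  set a := sInf (Set.range y) with ha_def
  have ha₀ : 0 ≤ a := ha.2 (by rintro _ ⟨i, rfl⟩; exact hy₀ i)
  have hTa : T a = a := hT.map_eq_of_isGLB hy (fun i => hT.idem _) ha
  have hQa : Q a = 0 := hQ.map_eq_zero_of_sum_le hT he hTe hQ' ha₀ hTa n fun i => by
    refine (Finset.sum_le_sum fun k _ => hT.mono ((P (n + k)).isOrderProj.mono
      (ha.1 ⟨k, rfl⟩))).trans ?_
    rw [hsum]
    exact sub_le_self _ (hy₀ i)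
  have hKa : T (K.toMap e) ≤ a := ha.2 (by
    rintro _ ⟨i, rfl⟩
    exact hT.mono (map_unit_le_noneOf hK he.1 i))
  refine (hQ'.comp K.isOrderProj).eq_zero_of_map_unit_eq_zero he ?_ x
  refine hT.eq_zero_of_map_nonpos (hQ'.nonneg _ (K.isOrderProj.nonneg e he.1)) ?_
  rw [LinearMap.comp_apply, hTQ, ← hQa]
  exact hQ'.mono hKa

/-- Both Borel–Cantelli lemmas combined: the limit superior of an independent sequence is the
projection onto the divergence part of `∑ T Pₙ e`. -/
theorem IsDivergenceProj.isLimsup (hT : IsConditionalExpectation T)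
    (he : IsWeakOrderUnit e) (hTe : T e = e) (hP : TIndependent T e P) {Q : BandProj X}
    (hQ : IsDivergenceProj (condSum T e P) e Q.toMap) : IsLimsup P Q := by
  have hQ' := Q.isOrderProj
  choose R K hR hRK hK using exists_isLUB_tail P
  refine ⟨R, hR, ?_, fun S hS x hx => ?_⟩
  · rintro _ ⟨n, rfl⟩ x hx
    have hKe : ∀ k, n ≤ k → (P k).toMap ((K n).toMap e) = 0 :=
      (hK n _ ((K n).isOrderProj.nonneg e he.1)).1 ((K n).isOrderProj.idem e)
    have h := hQ'.le_self _ (sub_nonneg.2 ((K n).isOrderProj.le_self x hx))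
    rw [map_sub, hQ.map_common_kernel_eq_zero hT he hTe hP hQ' hKe, sub_zero] at h
    rwa [hRK]
  · have hS' : ∀ n, S ≤ R n := fun n => hS ⟨n, rfl⟩
    choose D hD using fun m => exists_isLevelProj (condSum T e P) e m
    have hSx : Q.toMap (S.toMap x) = S.toMap x := hQ.map_eq_self hD (fun m => (D m).isOrderProj)
      (S.isOrderProj.nonneg x hx) fun m =>
        map_level_eq_zero_of_le_tail hT he hTe hRK hK hS' (hD m) x
    rw [← hSx]
    exact hQ'.mono (S.isOrderProj.le_self x hx)

end BorelCantelli

/-! ### Sup-completion and universal completion -/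

section Completion

variable {X : Type*} [AddCommGroup X] [ConditionallyCompleteLattice X] [IsOrderedAddMonoid X]

theorem Riesz.DirSet.cut_singleton {X : Type*} [ConditionallyCompleteLattice X] (x y : X) :
    DirSet.cut ⟨{y}, Set.singleton_nonempty y, directedOn_singleton y⟩ x = x ⊓ y := by
  simp [DirSet.cut]

/-- A sum in the sup-completion is computed by truncation: its truncation at `x` is the supremum of
the truncated partial sums. -/
theorem Riesz.HasSupSum.isLUB {x : ℕ → X} (hx : ∀ n, 0 ≤ x n) {A : DirSet X}
    (h : HasSupSum x (SupCompletion.mk A)) (w : X) :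
    IsLUB (Set.range fun n => w ⊓ ∑ k ∈ Finset.range n, x k) (A.cut w) := by
  have hmono : Monotone fun n => ∑ k ∈ Finset.range n, x k := monotone_nat_of_le_succ fun n => by
    rw [Finset.sum_range_succ]
    exact le_add_of_nonneg_right (hx n)
  let S : DirSet X := ⟨Set.range fun n => ∑ k ∈ Finset.range n, x k, Set.range_nonempty _,
    directedOn_range.2 hmono.directed_le⟩
  have hS : ∀ w, IsLUB (Set.range fun n => w ⊓ ∑ k ∈ Finset.range n, x k) (S.cut w) := fun w => by
    have h' := S.cut_isLUB w
    rwa [← Set.range_comp] at h'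
  have hub : SupCompletion.mk S ∈ upperBounds (Set.range fun n =>
      SupCompletion.of (∑ k ∈ Finset.range n, x k)) := by
    rintro _ ⟨n, rfl⟩ v
    rw [DirSet.cut_singleton]
    exact (hS v).1 ⟨n, rfl⟩
  refine ⟨?_, fun c hc => ?_⟩
  · rintro _ ⟨n, rfl⟩
    have h' : DirSet.cut ⟨{_}, _, _⟩ w ≤ A.cut w := h.1 ⟨n, rfl⟩ w
    rwa [DirSet.cut_singleton] at h'
  · have h' : A.cut w ≤ S.cut w := h.2 hub w
    exact h'.trans ((hS w).2 hc)

/-- A criterion by truncation: if the truncations `x ∧ sₙ` exhaust every positive `x` in the range of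
`Q`, and the only positive `x` in the kernel of `Q` with all multiples `m x` exhausted is `0`, then
`Q` projects onto the divergence part of `s`. -/
theorem isDivergenceProj_of_isLUB [Module ℝ X] {s : ℕ → X} (hs : ∀ n, 0 ≤ s n) {e : X}
    (he : IsWeakOrderUnit e) {Q : X →ₗ[ℝ] X} (hQ : IsOrderProj Q)
    (h₁ : ∀ x, 0 ≤ x → Q x = x → IsLUB (Set.range fun n => x ⊓ s n) x)
    (h₂ : ∀ x, 0 ≤ x → Q x = 0 →
      (∀ m : ℕ, IsLUB (Set.range fun n => (m • x) ⊓ s n) (m • x)) → x = 0) :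
    IsDivergenceProj s e Q := by
  intro x hx
  constructor
  · intro hQx m z hz hzx hzs
    have hQz := hQ.map_eq_self_of_le hz hzx hQx
    refine le_antisymm (nonpos_of_forall_nsmul_le (b := m • e) fun j => ?_) hz
    have hj : 0 ≤ j • z := nsmul_nonneg hz j
    refine (h₁ _ hj (by rw [map_nsmul, hQz])).2 ?_
    rintro _ ⟨n, rfl⟩
    have hme : 0 ≤ m • e := nsmul_nonneg he.1 m
    calc j • z ⊓ s n ≤ j • z ⊓ (m • e + (s n - m • e)⁺) := inf_le_inf_left _
          (sub_le_iff_le_add'.1 (le_posPart _))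
      _ ≤ m • e ⊓ j • z + (s n - m • e)⁺ ⊓ j • z := by
          rw [inf_comm]; exact add_inf_le_inf_add_inf hme (posPart_nonneg _) hj
      _ = m • e ⊓ j • z := by
          rw [inf_comm (s n - m • e)⁺, nsmul_inf_eq_zero hz (posPart_nonneg _) (hzs n), add_zero]
      _ ≤ m • e := inf_le_left
  · intro h
    have hw : 0 ≤ x - Q x := sub_nonneg.2 (hQ.le_self x hx)
    suffices hg : (x - Q x) ⊓ e = 0 from (sub_eq_zero.1 (he.2 _ hw hg)).symm
    have hg₀ : 0 ≤ (x - Q x) ⊓ e := le_inf hw he.1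
    refine h₂ _ hg₀ (hQ.map_eq_zero_of_le hg₀ inf_le_left (by simp [hQ.idem])) fun m => ?_
    set g := (x - Q x) ⊓ e with hg_def
    have hgx : g ≤ x := inf_le_left.trans (sub_le_self _ (hQ.nonneg x hx))
    refine ⟨by rintro _ ⟨n, rfl⟩; exact inf_le_left, fun c hc => ?_⟩
    -- The part of `m g` missed by the upper bound `c` lies below every `(sₙ - m e)⁻`.
    have hmiss : ∀ n, (m • g - c)⁺ ≤ (m • g - s n)⁺ := fun n => by
      have h' : (m • g - m • g ⊓ s n) = (m • g - s n)⁺ := by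
        rw [sub_inf, sub_self, posPart_def, sup_comm]
      rw [← h']
      exact sup_le (sub_le_sub_left (hc ⟨n, rfl⟩) _) (sub_nonneg.2 inf_le_left)
    have hdisj : ∀ n, (m • g - c)⁺ ⊓ (s n - m • e)⁺ = 0 := fun n => by
      refine inf_eq_zero_of_le (posPart_nonneg _) (b := (s n - m • e)⁻) ?_ (posPart_nonneg _)
        (by rw [inf_comm, posPart_inf_negPart_eq_zero])
      rw [← posPart_neg, neg_sub]
      exact (hmiss n).trans (posPart_mono
        (sub_le_sub_right (nsmul_le_nsmul_right inf_le_right m) _))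
    have hle : (m • g - c)⁺ ≤ m • x := (hmiss 0).trans (sup_le
      ((sub_le_self _ (hs 0)).trans (nsmul_le_nsmul_right hgx m)) (nsmul_nonneg hx m))
    have hzero : x ⊓ (m • g - c)⁺ = 0 :=
      h m _ (le_inf hx (posPart_nonneg _)) inf_le_left fun n => inf_eq_zero_of_le
        (le_inf hx (posPart_nonneg _)) inf_le_right (posPart_nonneg _) (hdisj n)
    have h' := nsmul_inf_eq_zero hx (posPart_nonneg _) hzero m
    rw [inf_eq_right.2 hle] at h'
    exact sub_nonpos.1 (posPart_eq_zero.1 h')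

end Completion

section UniversalCompletion

variable {X Y : Type*}
  [AddCommGroup X] [Module ℝ X] [ConditionallyCompleteLattice X]
  [AddCommGroup Y] [Module ℝ Y] [ConditionallyCompleteLattice Y]
  {ι : X →ₗ[ℝ] Y}

namespace Riesz.IsUniversalCompletion

theorem le_iff_le (hι : IsUniversalCompletion ι) {x y : X} : ι x ≤ ι y ↔ x ≤ y := by
  rw [← sup_eq_right, ← hι.map_sup, hι.injective.eq_iff, sup_eq_right]

theorem map_abs (hι : IsUniversalCompletion ι) (x : X) : ι |x| = |ι x| := by
  rw [abs, hι.map_sup, map_neg, abs]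

theorem pos_iff (hι : IsUniversalCompletion ι) {x : X} : 0 < ι x ↔ 0 < x := by
  rw [← map_zero ι, lt_iff_le_not_ge, hι.le_iff_le, hι.le_iff_le, ← lt_iff_le_not_ge]

variable [IsOrderedAddMonoid X] [IsOrderedAddMonoid Y]

/-- The embedding of an order dense Riesz subspace preserves all existing suprema. -/
theorem map_isLUB (hι : IsUniversalCompletion ι) {S : Set X} {m : X} (hm : IsLUB S m) :
    IsLUB (ι '' S) (ι m) := by
  refine ⟨by rintro _ ⟨s, hs, rfl⟩; exact hι.le_iff_le.2 (hm.1 hs), fun y hy => ?_⟩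
  by_contra hne
  have hpos : 0 < ι m - y ⊓ ι m :=
    lt_of_le_of_ne (sub_nonneg.2 inf_le_right) fun h =>
      hne (inf_eq_right.1 (sub_eq_zero.1 h.symm).symm)
  obtain ⟨z, hz, hzy⟩ := hι.orderDense _ hpos
  have h : m ≤ m - z := hm.2 fun s hs => by
    rw [← hι.le_iff_le, map_sub]
    exact (le_inf (hy ⟨s, hs, rfl⟩) (hι.le_iff_le.2 (hm.1 hs))).trans (le_sub_comm.1 hzy)
  exact (hι.pos_iff.1 hz).not_ge (by simpa using h)

/-- The trace on `X` of a band of the universal completion, as a band. -/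
def comapBand (hι : IsUniversalCompletion ι) (B : Band Y) : Band X where
  toSubmodule := B.toSubmodule.comap ι
  solid x y hx hyx := B.solid (ι x) (ι y) hx (by
    rw [← hι.map_abs, ← hι.map_abs]
    exact hι.le_iff_le.2 hyx)
  sup_mem S m hS hm := B.sup_mem (ι '' S) (ι m) (by rintro _ ⟨s, hs, rfl⟩; exact hS hs)
    (hι.map_isLUB hm)

theorem exists_isOnto [IsOrderedModule ℝ X] (hι : IsUniversalCompletion ι) (B : Band Y) :
    ∃ Q : BandProj X, Q.IsOnto ι B := by
  obtain ⟨Q, hQ⟩ := (hι.comapBand B).exists_bandProj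
  refine ⟨Q, fun x => ⟨(hQ x).1, fun b hb => ?_⟩⟩
  have h₀ : 0 ≤ |ι (x - Q.toMap x)| ⊓ |b| := le_inf (abs_nonneg _) (abs_nonneg _)
  by_contra hne
  obtain ⟨z, hz, hzb⟩ := hι.orderDense _ (lt_of_le_of_ne h₀ (Ne.symm hne))
  have hz₀ := hι.pos_iff.1 hz
  have hzB : z ∈ (hι.comapBand B).toSubmodule := B.solid b _ hb (by
    rw [abs_of_nonneg hz.le]
    exact hzb.trans inf_le_right)
  have h := (hQ x).2 z hzB
  rw [abs_of_nonneg hz₀.le, inf_eq_right.2] at h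
  · exact hz₀.ne' h
  · rw [← hι.le_iff_le, hι.map_abs]
    exact hzb.trans inf_le_left

/-- If `∑ xₙ = ∞_B + u`, then `P_B` projects onto the divergence part of the sum: on `B` the sum
dominates everything, and off `B` its truncations stay below the finite element `u`. -/
theorem isDivergenceProj [IsOrderedModule ℝ X] (hι : IsUniversalCompletion ι) {B : Band Y} {u : Y}
    (hu : 0 ≤ u) {x : ℕ → X} (hx : ∀ n, 0 ≤ x n)
    (h : HasSupSum x (hι.infty B + hι.toSup u hu)) {e : X} (he : IsWeakOrderUnit e)
    {Q : BandProj X} (hQ : Q.IsOnto ι B) :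
    IsDivergenceProj (fun n => ∑ k ∈ Finset.range n, x k) e Q.toMap := by
  obtain ⟨A, hA, hsum⟩ : ∃ A : DirSet X,
      A.carrier = {z | ∃ b, ι b ∈ B.toSubmodule ∧ ∃ v, ι v ≤ u ∧ z = b + v} ∧
      HasSupSum x (SupCompletion.mk A) := by
    refine ⟨_, ?_, h⟩
    ext z
    constructor
    · rintro ⟨b, hb, v, hv, rfl⟩; exact ⟨b, hb, v, hv, rfl⟩
    · rintro ⟨b, hb, v, hv, rfl⟩; exact ⟨b, hb, v, hv, rfl⟩
  have hlub := hsum.isLUB hx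
  refine isDivergenceProj_of_isLUB (fun n => Finset.sum_nonneg fun k _ => hx k) he Q.isOrderProj
    (fun w hw hQw => ?_) (fun w hw hQw hm => ?_)
  · have hcut : A.cut w = w := by
      refine le_antisymm ((A.cut_isLUB w).2 (by rintro _ ⟨a, _, rfl⟩; exact inf_le_left)) ?_
      refine (A.cut_isLUB w).1 ⟨w, ?_, inf_idem w⟩
      rw [hA]
      exact ⟨w, by rw [← hQw]; exact (hQ w).1, 0, by simpa using hu, by simp⟩
    simpa only [hcut] using hlub w
  · have hle : ∀ m : ℕ, m • ι w ≤ u := by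
      intro m
      have hmw : 0 ≤ m • w := nsmul_nonneg hw m
      rw [← map_nsmul, (hm m).unique (hlub (m • w))]
      refine (hι.map_isLUB (A.cut_isLUB (m • w))).2 ?_
      rintro _ ⟨_, ⟨a, ha, rfl⟩, rfl⟩
      rw [hA] at ha
      obtain ⟨b, hb, v, hv, rfl⟩ := ha
      have hdisj : |ι b| ⊓ ι (m • w) = 0 := by
        have h' := (hQ (m • w)).2 _ hb
        rw [map_nsmul, hQw, smul_zero, sub_zero, ← hι.map_abs, abs_of_nonneg hmw] at h'
        rwa [inf_comm]
      have hmw' : 0 ≤ ι (m • w) := by rwa [← map_zero ι, hι.le_iff_le]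
      calc ι (m • w ⊓ (b + v)) ≤ ι (b + v) ⊓ ι (m • w) :=
            le_inf (hι.le_iff_le.2 inf_le_right) (hι.le_iff_le.2 inf_le_left)
        _ ≤ (|ι b| + u) ⊓ ι (m • w) := by
            rw [map_add]
            exact inf_le_inf_right _ (add_le_add (le_abs_self _) hv)
        _ ≤ |ι b| ⊓ ι (m • w) + u ⊓ ι (m • w) := add_inf_le_inf_add_inf (abs_nonneg _) hu hmw'
        _ ≤ u := by rw [hdisj, zero_add]; exact inf_le_left
    have h' := nonpos_of_forall_nsmul_le hle
    rw [← map_zero ι, hι.le_iff_le] at h'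
    exact le_antisymm h' hw

end Riesz.IsUniversalCompletion

/-- If `∑ xₙ = ∞`, then the divergence part of the sum is the whole space. -/
theorem Riesz.HasSupSum.isDivergenceProj_one [IsOrderedAddMonoid X] {x : ℕ → X}
    (hx : ∀ n, 0 ≤ x n) (h : HasSupSum x ⊤) {e : X} (he : IsWeakOrderUnit e) :
    IsDivergenceProj (fun n => ∑ k ∈ Finset.range n, x k) e (1 : BandProj X).toMap := by
  obtain ⟨A, hA, hsum⟩ : ∃ A : DirSet X, A.carrier = Set.univ ∧ HasSupSum x (SupCompletion.mk A) :=
    ⟨_, rfl, h⟩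
  refine isDivergenceProj_of_isLUB (fun n => Finset.sum_nonneg fun k _ => hx k) he
    (1 : BandProj X).isOrderProj (fun w _ _ => ?_) (fun w _ hw _ => hw)
  have hcut : A.cut w = w := le_antisymm
    ((A.cut_isLUB w).2 (by rintro _ ⟨a, _, rfl⟩; exact inf_le_left))
    ((A.cut_isLUB w).1 ⟨w, by rw [hA]; trivial, inf_idem w⟩)
  simpa only [hcut] using hsum.isLUB hx w

end UniversalCompletion

theorem theorem4p3 {X Y : Type*}
    [AddCommGroup X] [Module ℝ X] [ConditionallyCompleteLattice X] [IsOrderedAddMonoid X]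
    [IsOrderedModule ℝ X]
    [AddCommGroup Y] [Module ℝ Y] [ConditionallyCompleteLattice Y] [IsOrderedAddMonoid Y]
    [IsOrderedModule ℝ Y]
    (ι : X →ₗ[ℝ] Y) (hι : IsUniversalCompletion ι)
    (e : X) (he : IsWeakOrderUnit e)
    (T : X →ₗ[ℝ] X) (hT : IsConditionalExpectation T) (hTe : T e = e)
    (P : ℕ → BandProj X) (hP : TIndependent T e P) :
    (∀ (B : Band Y) (u : Y) (hu : 0 ≤ u), u ∈ B.compl →
      HasSupSum (fun n => T ((P n).toMap e)) (hι.infty B + hι.toSup u hu) →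
        ∃ Q : BandProj X, Q.IsOnto ι B ∧ (∀ x, Q.toMap (T x) = T (Q.toMap x)) ∧ IsLimsup P Q) ∧
    (HasSupSum (fun n => T ((P n).toMap e)) ⊤ → IsLimsup P 1) := by
  have hx : ∀ n, 0 ≤ T ((P n).toMap e) :=
    fun n => hT.map_nonneg ((P n).isOrderProj.nonneg e he.1)
  refine ⟨fun B u hu _ hsum => ?_, fun hsum => ?_⟩
  · obtain ⟨Q, hQ⟩ := hι.exists_isOnto B
    have hdiv : IsDivergenceProj (condSum T e P) e Q.toMap := hι.isDivergenceProj hu hx hsum he hQ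
    exact ⟨Q, hQ, fun x => (hdiv.commute Q.isOrderProj hT he hTe (condSum_mono hT he.1)
      (map_condSum hT) x).symm, hdiv.isLimsup hT he hTe hP⟩
  · have hdiv : IsDivergenceProj (condSum T e P) e (1 : BandProj X).toMap :=
      hsum.isDivergenceProj_one hx he
    exact hdiv.isLimsup hT he hTe hP
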